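/- Let $\theta\in[0,\pi)$ and $s>\tfrac12$, and let $m_0\in H^s(\mathbb R)\cap L^1(\mathbb R)$ be complex-valued. Consider the Cauchy problem $$m_t+\big(\mathrm{Re}(e^{i\theta}Q)\,m\big)_x-i\,\mathrm{Im}(e^{i\theta}Q)\,m=0,\qquad m=u-u_{xx},\qquad Q=(u+u_x)(\bar u-\bar u_x),\qquad m|_{t=0}=m_0,$$ on the real line. A solution on $[0,T)$, $0<T\le\infty$, is a function $m\in C([0,T);H^s(\mathbb R))\cap C^1([0,T);H^{s-1}(\mathbb R))$ with $m(0)=m_0$, where $u(t)=(1-\partial_x^2)^{-1}m(t)$, for which the equation holds as an equality of tempered distributions in $x$ for every $t\in[0,T)$. Let $m$ be the solution on its maximal interval of existence $[0,T^*)$, $0<T^*\le\infty$. Then, for all $0\le t<T^*$, $m(t,\cdot)\in L^1(\mathbb R)$ and $$\frac{d}{dt}\int_{\mathbb R}|m(t,x)|\,dx=0$$ (a one-sided derivative at $t=0$), and hence $$\|m(t)\|_{L^1(\mathbb R)}=\|m_0\|_{L^1(\mathbb R)}.$$ Here $|m|=\sqrt{m\bar m}$ is the complex modulus, so that this $L^1$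 norm is invariant under $m\mapsto e^{i\phi}m$, $\phi\in\mathbb R$. -/

import Mathlib

namespace Peakon

open MeasureTheory TemperedDistribution

open scoped SchwartzMap

/-- The time interval `[0, T)`, where `T = ⊤` is allowed. -/
def timeInterval (T : EReal) : Set ℝ := {t : ℝ | 0 ≤ t ∧ (t : EReal) < T}

/-- The square-integrable function `f` belongs to the Sobolev space `H^σ(ℝ)`. -/
def MemSobolevSpace (σ : ℝ) (f : ℝ → ℂ) : Prop :=
  ∃ hf : MemLp f 2 (volume : Measure ℝ),
    MemSobolev σ 2 ((hf.toLp f : Lp ℂ 2 (volume : Measure ℝ)) : 𝓢'(ℝ, ℂ))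

/-- `t ↦ f t` belongs to `C^k(I; H^σ(ℝ))`, for a curve of square-integrable functions `f t`.
The Bessel potential of order `σ` identifies `H^σ(ℝ)` (as a Banach space, up to an equivalent norm)
with `L²(ℝ)`, so this says that the Bessel potential of `f t` is, for `t ∈ I`, a `C^k` curve in
`L²(ℝ)`. The order `σ` may be negative. -/
def ContDiffInSobolev (k : ℕ) (σ : ℝ) (I : Set ℝ) (f : ℝ → ℝ → ℂ) : Prop :=
  ∃ g : ℝ → Lp ℂ 2 (volume : Measure ℝ), ContDiffOn ℝ k g I ∧
    ∀ t ∈ I, ∃ hf : MemLp (f t) 2 (volume : Measure ℝ),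
      besselPotential ℝ ℂ σ ((hf.toLp (f t) : Lp ℂ 2 (volume : Measure ℝ)) : 𝓢'(ℝ, ℂ)) =
        (g t : 𝓢'(ℝ, ℂ))

/-- `Q = (u + u_x) (ū - ū_x)`, for a function `v = u(t, ·)` of the space variable. -/
noncomputable def Q (v : ℝ → ℂ) (x : ℝ) : ℂ :=
  (v x + deriv v x) * (starRingEnd ℂ (v x) - starRingEnd ℂ (deriv v x))

/-- `e^{iθ} Q`; its real part is the transport velocity `J`. -/
noncomputable def rotQ (θ : ℝ) (v : ℝ → ℂ) (x : ℝ) : ℂ :=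
  Complex.exp (Complex.I * θ) * Q v x

/-- `m = u - u_xx` solves, with initial datum `m₀`, the peakon equation
`m_t + (Re(e^{iθ}Q) m)_x - i Im(e^{iθ}Q) m = 0` on `[0, T) × ℝ`, in the class
`C([0, T); H^s) ∩ C¹([0, T); H^{s-1})`.

As `m t ∈ H^s` with `s > 1/2`, `m t` is a continuous function and `u t = (1 - ∂ₓ²)⁻¹ (m t)` is `C²`,
so that `u`, `u_x` and `m` are taken pointwise. The time derivative of `m` is a distribution (an
element of `H^{s-1}`), so the equation is an equality of tempered distributions at every time. -/
structure IsSolution (θ s : ℝ) (m₀ : ℝ → ℂ) (T : EReal) (u m : ℝ → ℝ → ℂ) : Prop where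
  pos : 0 < T
  contDiff : ∀ t ∈ timeInterval T, ContDiff ℝ 2 (u t)
  memLp : ∀ t ∈ timeInterval T, MemLp (u t) 2 (volume : Measure ℝ)
  momentum : ∀ t ∈ timeInterval T, ∀ x : ℝ, m t x = u t x - iteratedDeriv 2 (u t) x
  continuous_sobolev : ContDiffInSobolev 0 s (timeInterval T) m
  contDiff_sobolev : ContDiffInSobolev 1 (s - 1) (timeInterval T) m
  initial : m 0 =ᵐ[volume] m₀
  equation : ∀ t ∈ timeInterval T, ∀ φ : 𝓢(ℝ, ℂ),
    HasDerivWithinAt (fun τ : ℝ ↦ ∫ x : ℝ, m τ x * φ x)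
      ((∫ x : ℝ, ((rotQ θ (u t) x).re : ℂ) * m t x * deriv φ x) +
        ∫ x : ℝ, Complex.I * ((rotQ θ (u t) x).im : ℂ) * m t x * φ x)
      (timeInterval T) t

/-- `m` is the solution on its maximal interval of existence `[0, T)`: no solution in the same class
with the same initial datum lives on a longer interval. -/
structure IsMaximalSolution (θ s : ℝ) (m₀ : ℝ → ℂ) (T : EReal) (u m : ℝ → ℝ → ℂ) : Prop where
  isSolution : IsSolution θ s m₀ T u m
  maximal : ∀ (T' : EReal) (u' m' : ℝ → ℝ → ℂ), IsSolution θ s m₀ T' u' m' → T' ≤ T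

end Peakon

/-!
The modulus of `m` satisfies the conservation law `|m|_t + (J |m|)_x = 0` with `J = Re (e^{iθ} Q)`:
the term `i Im (e^{iθ} Q) m` is orthogonal to `m` in `ℂ = ℝ²` and only rotates its phase. As `J` is
integrable and `m` is bounded, no mass escapes to infinity, and `∫ |m|` is constant.

**Regularity.** The Sobolev embedding (`exists_norm_le_of_besselPotential_eq`, by duality against
Schwartz functions) turns continuity of `m` in `H^s` into uniform continuity in `x` and joint
continuity in `(t, x)`. An energy estimate for `m = u - u''` (`integrable_energy`) bounds `u ± u'` in
`L²`, and then, since `(u ± u')' = ±((u ± u') - m)`, also in `L^∞`. By linearity the same bounds hold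
for differences of two times, so `u ± u'` are jointly continuous. Hence `J = Re (e^{iθ} p q̄)`, with
`p = u + u'` and `q = u - u'`, is bounded in `L¹` on compact time intervals, and
`J_x = Re (e^{iθ} (p m̄ - m q̄))` is continuous.

**Renormalization.** The equation holds only in the sense of distributions, so `|m|` cannot be
differentiated directly. Mollifying in space at scale `ε` gives a function that is differentiable in
`t` and `x` and solves the equation up to a commutator. As `J` is `C¹` in `x` and `m` is continuous,
the commutator extends continuously to `ε = 0`, where it vanishes (`commutator_zero`). The function
`√(|m_ε|² + ε²)` therefore satisfies the conservation law up to an error that tends to zero, uniformly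
in time on compact sets (`abs_integral_norm_sub_le`).

**Conclusion.** Against the weight `1 - x² / R²` on `[-R, R]` the change of `∫ |m|` over `[0, t]` is
`O(1 / R)` (`integral_flux_le`); `R → ∞` gives integrability of `m(t)` and equality of the integrals
(`integrable_and_integral_eq_of_weighted`). The derivative in time is that of a constant.
-/

namespace Peakon

open MeasureTheory TemperedDistribution

open scoped SchwartzMap

/-! ### The Sobolev space `H^s(ℝ)` for `s > 1/2` -/

open FourierTransform

open scoped ENNReal

/-- The symbol of the Bessel potential of order `-s` is square integrable for `s > 1/2`. -/
theorem memLp_two_bessel_symbol {s : ℝ} (hs : 1 / 2 < s) :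
    MemLp (fun x : ℝ ↦ (((1 + ‖x‖ ^ 2) ^ (-s / 2) : ℝ) : ℂ)) 2 volume := by
  have hc : Continuous (fun x : ℝ ↦ ((1 + ‖x‖ ^ 2) ^ (-s / 2) : ℝ)) :=
    Continuous.rpow_const (by fun_prop) (fun x ↦ Or.inl (by positivity))
  refine MemLp.ofReal ((memLp_two_iff_integrable_sq hc.aestronglyMeasurable).2 ?_)
  have h := integrable_rpow_neg_one_add_norm_sq (E := ℝ) (μ := volume) (r := 2 * s)
    (by simp; linarith)
  refine h.congr (Filter.Eventually.of_forall fun x ↦ ?_)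
  simp only
  rw [← Real.rpow_mul_natCast (by positivity)]
  congr 1
  push_cast
  ring

theorem memLp_top_bessel_symbol {s : ℝ} (hs : 0 ≤ s) :
    MemLp (fun x : ℝ ↦ (((1 + ‖x‖ ^ 2) ^ (-s / 2) : ℝ) : ℂ)) ∞ volume := by
  have hc : Continuous (fun x : ℝ ↦ ((1 + ‖x‖ ^ 2) ^ (-s / 2) : ℝ)) :=
    Continuous.rpow_const (by fun_prop) (fun x ↦ Or.inl (by positivity))
  refine memLp_top_of_bound (Complex.continuous_ofReal.comp hc).aestronglyMeasurable 1
    (Filter.Eventually.of_forall fun x ↦ ?_)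
  rw [Complex.norm_real, Real.norm_eq_abs, abs_of_nonneg (by positivity)]
  exact Real.rpow_le_one_of_one_le_of_nonpos (by simp; positivity) (by linarith)

theorem fourier_eq_smulLeftCLM_of_besselPotential_eq {s : ℝ} {f g : 𝓢'(ℝ, ℂ)}
    (h : besselPotential ℝ ℂ s f = g) :
    𝓕 f = smulLeftCLM ℂ (fun x : ℝ ↦ (((1 + ‖x‖ ^ 2) ^ (-s / 2) : ℝ) : ℂ)) (𝓕 g) := by
  have h' : besselPotential ℝ ℂ (-s) g = f := by simp [← h]
  rw [← h', fourier_besselPotential_eq_smulLeftCLM_fourier_apply]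

/-- For `s ≥ 0` the `L²` norm is at most the `H^s` norm. -/
theorem norm_le_of_besselPotential_eq {s : ℝ} (hs : 0 ≤ s)
    {f g : Lp ℂ 2 (volume : Measure ℝ)}
    (h : besselPotential ℝ ℂ s (f : 𝓢'(ℝ, ℂ)) = (g : 𝓢'(ℝ, ℂ))) : ‖f‖ ≤ ‖g‖ := by
  have hw := memLp_top_bessel_symbol hs
  have h1 := fourier_eq_smulLeftCLM_of_besselPotential_eq h
  rw [Lp.fourier_toTemperedDistribution_eq, Lp.fourier_toTemperedDistribution_eq,
    ← Lp.toTemperedDistribution_smul_eq (p := ∞) (q := 2) (r := 2) (by fun_prop) hw] at h1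
  have h2 : 𝓕 f = hw.toLp _ • 𝓕 g :=
    LinearMap.ker_eq_bot.1 (Lp.ker_toTemperedDistributionCLM_eq_bot (E := ℝ) (F := ℂ)
      (μ := volume) (p := 2)) h1
  rw [← Lp.norm_fourier_eq f, ← Lp.norm_fourier_eq g, h2]
  refine (Lp.norm_smul_le _ _).trans (mul_le_of_le_one_left (norm_nonneg _) ?_)
  rw [Lp.norm_toLp, eLpNorm_exponent_top]
  refine ENNReal.toReal_le_of_le_ofReal zero_le_one
    (eLpNormEssSup_le_of_ae_bound (Filter.Eventually.of_forall fun x ↦ ?_))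
  rw [Complex.norm_real, Real.norm_eq_abs, abs_of_nonneg (by positivity)]
  exact Real.rpow_le_one_of_one_le_of_nonpos (by simp; positivity) (by linarith)

/-- A continuous function which is bounded by `C` as a functional on `L¹`, tested against Schwartz
functions, is bounded by `C` pointwise. -/
theorem norm_le_of_forall_schwartz {f : ℝ → ℂ} (hf : Continuous f) {C : ℝ}
    (h : ∀ φ : 𝓢(ℝ, ℂ), ‖∫ x, φ x * f x‖ ≤ C * ∫ x, ‖φ x‖) (x : ℝ) : ‖f x‖ ≤ C := by
  refine le_of_forall_pos_le_add fun κ hκ ↦ ?_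
  obtain ⟨δ, hδ, hδf⟩ := Metric.continuous_iff.1 hf x κ hκ
  let b : ContDiffBump x := ⟨δ / 2, δ, by positivity, by linarith⟩
  have hcs : HasCompactSupport (fun y ↦ ((b.normed volume y : ℝ) : ℂ)) :=
    b.hasCompactSupport_normed.comp_left (g := fun r : ℝ ↦ (r : ℂ)) rfl
  have hcd : ContDiff ℝ (⊤ : ℕ∞) (fun y ↦ ((b.normed volume y : ℝ) : ℂ)) :=
    Complex.ofRealCLM.contDiff.comp b.contDiff_normed
  have h1 := h (hcs.toSchwartzMap hcd)
  simp only [HasCompactSupport.toSchwartzMap_toFun] at h1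
  have h2 : ∫ y, ‖((b.normed volume y : ℝ) : ℂ)‖ = 1 := by
    rw [← b.integral_normed (μ := volume)]
    exact integral_congr_ae (Filter.Eventually.of_forall fun y ↦ by
      simp [abs_of_nonneg (b.nonneg_normed y)])
  have hint : Integrable (fun y ↦ ((b.normed volume y : ℝ) : ℂ) * f y) :=
    (hcd.continuous.mul hf).integrable_of_hasCompactSupport hcs.mul_right
  have hint2 : Integrable (fun y ↦ ((b.normed volume y : ℝ) : ℂ) * f x) :=
    (hcd.continuous.integrable_of_hasCompactSupport hcs).mul_const _
  have h3 : ∫ y, ((b.normed volume y : ℝ) : ℂ) * f x = f x := by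
    rw [integral_mul_const, integral_complex_ofReal, b.integral_normed]
    simp
  have h4 : ‖f x - ∫ y, ((b.normed volume y : ℝ) : ℂ) * f y‖ ≤ κ := by
    nth_rewrite 1 [← h3]
    rw [← integral_sub hint2 hint]
    calc _ ≤ ∫ y, b.normed volume y * κ := by
            refine norm_integral_le_of_norm_le (b.integrable_normed.mul_const κ)
              (Filter.Eventually.of_forall fun y ↦ ?_)
            rw [← mul_sub, norm_mul, Complex.norm_real, Real.norm_eq_abs,
              abs_of_nonneg (b.nonneg_normed y)]
            by_cases hy : y ∈ Metric.ball x δ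
            · refine mul_le_mul_of_nonneg_left ?_ (b.nonneg_normed y)
              rw [← dist_eq_norm, dist_comm]
              exact (hδf y hy).le
            · have : b.normed volume y = 0 := by
                rw [← Function.notMem_support, b.support_normed_eq]
                exact hy
              simp [this]
      _ = κ := by rw [integral_mul_const, b.integral_normed, one_mul]
  rw [h2, mul_one] at h1
  calc ‖f x‖ = ‖(∫ y, ((b.normed volume y : ℝ) : ℂ) * f y) +
        (f x - ∫ y, ((b.normed volume y : ℝ) : ℂ) * f y)‖ := by congr 1; ring
    _ ≤ C + κ := (norm_add_le _ _).trans (add_le_add h1 h4)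

/-- The Sobolev embedding `H^s(ℝ) ⊆ L^∞(ℝ)` for `s > 1/2`, for continuous representatives. -/
theorem exists_norm_le_of_besselPotential_eq {s : ℝ} (hs : 1 / 2 < s) :
    ∃ C : ℝ, 0 ≤ C ∧ ∀ (f : ℝ → ℂ) (hf : MemLp f 2 (volume : Measure ℝ))
      (g : Lp ℂ 2 (volume : Measure ℝ)), Continuous f →
      besselPotential ℝ ℂ s ((hf.toLp f : Lp ℂ 2 (volume : Measure ℝ)) : 𝓢'(ℝ, ℂ)) =
        (g : 𝓢'(ℝ, ℂ)) → ∀ x, ‖f x‖ ≤ C * ‖g‖ := by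
  have hw := memLp_two_bessel_symbol hs
  refine ⟨‖hw.toLp _‖, norm_nonneg _, fun f hf g hfc h ↦ norm_le_of_forall_schwartz hfc fun φ ↦ ?_⟩
  have h1 := fourier_eq_smulLeftCLM_of_besselPotential_eq h
  rw [Lp.fourier_toTemperedDistribution_eq g,
    ← Lp.toTemperedDistribution_smul_eq (p := 2) (q := 2) (r := 1) (by fun_prop) hw] at h1
  set v : Lp ℂ 1 (volume : Measure ℝ) := hw.toLp _ • 𝓕 g with hv
  have hvn : ‖v‖ ≤ ‖hw.toLp _‖ * ‖g‖ := by
    rw [← Lp.norm_fourier_eq g]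
    exact Lp.norm_smul_le _ _
  -- Parseval: the pairing of `f` with `φ` is the pairing of its Fourier transform with `𝓕⁻ φ`.
  have h2 : ∫ x, φ x * f x = ∫ ξ, (𝓕⁻ φ) ξ • v ξ := by
    rw [← Lp.toTemperedDistribution_apply, ← h1, TemperedDistribution.fourier_apply,
      fourier_fourierInv_eq, Lp.toTemperedDistribution_apply]
    refine integral_congr_ae ?_
    filter_upwards [hf.coeFn_toLp] with x hx
    rw [hx, smul_eq_mul]
  have hφ : ∀ ξ, ‖(𝓕⁻ φ) ξ‖ ≤ ∫ x, ‖φ x‖ := fun ξ ↦ by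
    rw [SchwartzMap.fourierInv_coe, Real.fourierInv_eq]
    refine (norm_integral_le_integral_norm _).trans (le_of_eq ?_)
    simp
  have hvi : Integrable v volume := memLp_one_iff_integrable.1 (Lp.memLp v)
  rw [h2]
  calc ‖∫ ξ, (𝓕⁻ φ) ξ • v ξ‖ ≤ ∫ ξ, (∫ x, ‖φ x‖) * ‖v ξ‖ := by
        refine norm_integral_le_of_norm_le (hvi.norm.const_mul _)
          (Filter.Eventually.of_forall fun ξ ↦ ?_)
        rw [norm_smul]
        exact mul_le_mul_of_nonneg_right (hφ ξ) (norm_nonneg _)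
    _ = (∫ x, ‖φ x‖) * ‖v‖ := by
        rw [integral_const_mul, L1.norm_eq_integral_norm]
    _ ≤ ‖hw.toLp _‖ * ‖g‖ * ∫ x, ‖φ x‖ := by
        rw [mul_comm]
        exact mul_le_mul_of_nonneg_right hvn (integral_nonneg fun _ ↦ norm_nonneg _)

/-! ### The equation `m = u - u''` in `L²(ℝ)` -/

/-- One-dimensional Sobolev embedding `H¹(ℝ) ⊆ L^∞(ℝ)`. -/
theorem norm_sq_le_of_hasDerivAt {f f' : ℝ → ℂ} (hf : ∀ x, HasDerivAt f (f' x) x)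
    (hf' : Continuous f') (hi : Integrable fun x ↦ ‖f x‖ ^ 2)
    (hi' : Integrable fun x ↦ ‖f' x‖ ^ 2) (x : ℝ) :
    ‖f x‖ ^ 2 ≤ 2 * (∫ y, ‖f y‖ ^ 2) + ∫ y, ‖f' y‖ ^ 2 := by
  have hc : Continuous f := continuous_iff_continuousAt.2 fun x ↦ (hf x).continuousAt
  have key : ∀ y, ‖f x‖ ^ 2 ≤ ‖f y‖ ^ 2 + ((∫ y, ‖f y‖ ^ 2) + ∫ y, ‖f' y‖ ^ 2) := by
    intro y
    have h1 : ∫ z in y..x, 2 * inner ℝ (f z) (f' z) = ‖f x‖ ^ 2 - ‖f y‖ ^ 2 :=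
      intervalIntegral.integral_eq_sub_of_hasDerivAt (fun z _ ↦ (hf z).norm_sq)
        (Continuous.intervalIntegrable (by fun_prop) _ _)
    have h2 : |∫ z in y..x, 2 * inner ℝ (f z) (f' z)| ≤ ∫ z, (‖f z‖ ^ 2 + ‖f' z‖ ^ 2) := by
      rw [← Real.norm_eq_abs, intervalIntegral.norm_integral_eq_norm_integral_uIoc]
      refine (norm_integral_le_of_norm_le (hi.add hi').integrableOn
        (Filter.Eventually.of_forall fun z ↦ ?_)).trans
        (setIntegral_le_integral (hi.add hi') (Filter.Eventually.of_forall fun z ↦ ?_))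
      · have h3 := abs_real_inner_le_norm (f z) (f' z)
        rw [Real.norm_eq_abs, abs_mul, abs_two]
        simp only [Pi.add_apply]
        nlinarith [sq_nonneg (‖f z‖ - ‖f' z‖)]
      · simp only [Pi.add_apply, Pi.zero_apply]
        positivity
    rw [integral_add hi hi', h1] at h2
    linarith [le_abs_self (‖f x‖ ^ 2 - ‖f y‖ ^ 2)]
  have h4 : ∫ y in (0 : ℝ)..1, ‖f x‖ ^ 2 ≤
      ∫ y in (0 : ℝ)..1, (‖f y‖ ^ 2 + ((∫ y, ‖f y‖ ^ 2) + ∫ y, ‖f' y‖ ^ 2)) :=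
    intervalIntegral.integral_mono zero_le_one (by simp)
      (Continuous.intervalIntegrable (by fun_prop) _ _) key
  rw [intervalIntegral.integral_add (Continuous.intervalIntegrable (by fun_prop) _ _) (by simp),
    intervalIntegral.integral_const, intervalIntegral.integral_const] at h4
  have h5 : ∫ y in (0 : ℝ)..1, ‖f y‖ ^ 2 ≤ ∫ y, ‖f y‖ ^ 2 := by
    rw [intervalIntegral.integral_of_le zero_le_one]
    exact setIntegral_le_integral hi (Filter.Eventually.of_forall fun z ↦ by positivity)
  simp only [sub_zero, one_smul] at h4
  linarith

/-- Localized energy estimate for `m = u - u''`: multiply by `ū c²` with `c = 1 - x² / R²`, which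
vanishes at `± R`, and integrate by parts. -/
theorem integral_energy_le {u v w : ℝ → ℂ} (hu : ∀ x, HasDerivAt u (v x) x)
    (hv : ∀ x, HasDerivAt v (w x) x) (hw : Continuous w) (hi : Integrable fun x ↦ ‖u x‖ ^ 2)
    (hm : Integrable fun x ↦ ‖u x - w x‖ ^ 2) {r : ℝ} (hr : 0 < r) :
    ∫ x in -r..r, (‖u x‖ ^ 2 + ‖v x‖ ^ 2) ≤
      2 * (∫ x, ‖u x - w x‖ ^ 2) + 8 / r ^ 2 * ∫ x, ‖u x‖ ^ 2 := by
  have hcu : Continuous u := continuous_iff_continuousAt.2 fun x ↦ (hu x).continuousAt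
  have hcv : Continuous v := continuous_iff_continuousAt.2 fun x ↦ (hv x).continuousAt
  set R : ℝ := 2 * r with hR
  have hRp : 0 < R := by positivity
  set c : ℝ → ℝ := fun x ↦ 1 - x ^ 2 / R ^ 2 with hc
  set c' : ℝ → ℝ := fun x ↦ -(2 * x / R ^ 2) with hc'
  have hcd : ∀ x, HasDerivAt c (c' x) x := fun x ↦ by
    simpa [hc, hc'] using ((hasDerivAt_pow 2 x).div_const (R ^ 2)).const_sub 1
  have hcc : Continuous c := by fun_prop
  have hcc' : Continuous c' := by fun_prop
  set F' : ℝ → ℝ := fun x ↦ (inner ℝ (u x) (w x) + inner ℝ (v x) (v x)) * c x ^ 2 +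
    inner ℝ (u x) (v x) * (2 * c x * c' x) with hF'
  have hFd : ∀ x, HasDerivAt (fun x ↦ inner ℝ (u x) (v x) * c x ^ 2) (F' x) x := fun x ↦ by
    have h1 := ((hu x).inner ℝ (hv x)).mul ((hcd x).pow 2)
    refine h1.congr_deriv ?_
    simp [hF']
  have hF'c : Continuous F' := by fun_prop
  have hF0 : ∫ x in -R..R, F' x = 0 := by
    rw [intervalIntegral.integral_eq_sub_of_hasDerivAt (fun x _ ↦ hFd x)
      (hF'c.intervalIntegrable _ _)]
    have h1 : c R = 0 := by simp only [hc]; field_simp; simp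
    have h2 : c (-R) = 0 := by simp only [hc]; field_simp; simp
    simp [h1, h2]
  have hpt : ∀ x ∈ Set.Icc (-R) R, (‖u x‖ ^ 2 + ‖v x‖ ^ 2) * c x ^ 2 ≤
      (‖u x - w x‖ ^ 2 + 16 / R ^ 2 * ‖u x‖ ^ 2) + 2 * F' x := by
    intro x hx
    have hx2 : x ^ 2 ≤ R ^ 2 := sq_le_sq' hx.1 hx.2
    have hc1 : 0 ≤ c x := by
      simp only [hc, sub_nonneg]
      exact div_le_one_of_le₀ hx2 (by positivity)
    have hc2 : c x ≤ 1 := by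
      simp only [hc, sub_le_self_iff]
      positivity
    have hc3 : 4 * c' x ^ 2 ≤ 16 / R ^ 2 := by
      simp only [hc']
      rw [neg_sq, div_pow, mul_pow, ← mul_div_assoc, div_le_div_iff₀ (by positivity) (by positivity)]
      nlinarith [mul_le_mul_of_nonneg_left hx2 (sq_nonneg R)]
    -- `⟪u, w⟫ = ‖u‖² - ⟪u, m⟫` and Young's inequality.
    have h1 : inner ℝ (u x) (w x) = ‖u x‖ ^ 2 - inner ℝ (u x) (u x - w x) := by
      rw [inner_sub_right, real_inner_self_eq_norm_sq]; ring
    have h2 := real_inner_le_norm (u x) (u x - w x)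
    have h4 : ‖u x - w x‖ ^ 2 * c x ^ 2 ≤ ‖u x - w x‖ ^ 2 :=
      mul_le_of_le_one_right (by positivity) (by nlinarith)
    have h5 : 4 * c' x ^ 2 * ‖u x‖ ^ 2 ≤ 16 / R ^ 2 * ‖u x‖ ^ 2 :=
      mul_le_mul_of_nonneg_right hc3 (by positivity)
    have h6 : -(2 * inner ℝ (u x) (v x) * (2 * c x * c' x)) ≤
        ‖v x‖ ^ 2 * c x ^ 2 + 4 * c' x ^ 2 * ‖u x‖ ^ 2 := by
      have h7 : |2 * inner ℝ (u x) (v x) * (2 * c x * c' x)| ≤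
          2 * (‖u x‖ * ‖v x‖) * (2 * c x * |c' x|) := by
        rw [abs_mul, abs_mul, abs_two, abs_mul, abs_mul, abs_two, abs_of_nonneg hc1]
        have := abs_real_inner_le_norm (u x) (v x)
        gcongr
      have h8 := neg_abs_le (2 * inner ℝ (u x) (v x) * (2 * c x * c' x))
      have h9 : |c' x| ^ 2 = c' x ^ 2 := sq_abs _
      nlinarith [sq_nonneg (‖v x‖ * c x - 2 * |c' x| * ‖u x‖)]
    have h10 : 2 * inner ℝ (u x) (u x - w x) * c x ^ 2 ≤
        (‖u x‖ ^ 2 + ‖u x - w x‖ ^ 2) * c x ^ 2 := by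
      refine mul_le_mul_of_nonneg_right ?_ (sq_nonneg _)
      nlinarith [sq_nonneg (‖u x‖ - ‖u x - w x‖)]
    simp only [hF', h1, real_inner_self_eq_norm_sq]
    nlinarith
  have hint : ∫ x in -R..R, (‖u x‖ ^ 2 + ‖v x‖ ^ 2) * c x ^ 2 ≤
      (∫ x, ‖u x - w x‖ ^ 2) + 16 / R ^ 2 * ∫ x, ‖u x‖ ^ 2 := by
    have hg : Integrable fun x ↦ ‖u x - w x‖ ^ 2 + 16 / R ^ 2 * ‖u x‖ ^ 2 :=
      hm.add (hi.const_mul _)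
    calc _ ≤ ∫ x in -R..R, ((‖u x - w x‖ ^ 2 + 16 / R ^ 2 * ‖u x‖ ^ 2) + 2 * F' x) :=
          intervalIntegral.integral_mono_on (by linarith)
            (Continuous.intervalIntegrable (by fun_prop) _ _)
            (Continuous.intervalIntegrable (by fun_prop) _ _) hpt
      _ = ∫ x in -R..R, (‖u x - w x‖ ^ 2 + 16 / R ^ 2 * ‖u x‖ ^ 2) := by
          rw [intervalIntegral.integral_add (Continuous.intervalIntegrable (by fun_prop) _ _)
            (Continuous.intervalIntegrable (by fun_prop) _ _),
            intervalIntegral.integral_const_mul, hF0]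
          simp
      _ ≤ ∫ x, (‖u x - w x‖ ^ 2 + 16 / R ^ 2 * ‖u x‖ ^ 2) := by
          rw [intervalIntegral.integral_of_le (by linarith)]
          exact setIntegral_le_integral hg (Filter.Eventually.of_forall fun x ↦ by
            simp only [Pi.zero_apply]; positivity)
      _ = _ := by rw [integral_add hm (hi.const_mul _), integral_const_mul]
  -- On `[-r, r]` the weight is at least `9 / 16`.
  have hlow : ∫ x in -r..r, (‖u x‖ ^ 2 + ‖v x‖ ^ 2) ≤
      2 * ∫ x in -R..R, (‖u x‖ ^ 2 + ‖v x‖ ^ 2) * c x ^ 2 := by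
    rw [← intervalIntegral.integral_const_mul]
    calc _ ≤ ∫ x in -r..r, 2 * ((‖u x‖ ^ 2 + ‖v x‖ ^ 2) * c x ^ 2) := by
          refine intervalIntegral.integral_mono_on (by linarith)
            (Continuous.intervalIntegrable (by fun_prop) _ _)
            (Continuous.intervalIntegrable (by fun_prop) _ _) fun x hx ↦ ?_
          have h1 : 3 / 4 ≤ c x := by
            have hx2 : x ^ 2 ≤ r ^ 2 := sq_le_sq' hx.1 hx.2
            have : x ^ 2 / R ^ 2 ≤ 1 / 4 := by
              rw [div_le_div_iff₀ (by positivity) (by norm_num), hR]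
              nlinarith
            simp only [hc]
            linarith
          have h2 : 1 ≤ 2 * c x ^ 2 := by nlinarith
          nlinarith [mul_le_mul_of_nonneg_left h2
            (show 0 ≤ ‖u x‖ ^ 2 + ‖v x‖ ^ 2 by positivity)]
      _ ≤ _ := by
          refine intervalIntegral.integral_mono_interval (by linarith) (by linarith) (by linarith)
            (Filter.Eventually.of_forall fun x ↦ ?_)
            (Continuous.intervalIntegrable (by fun_prop) _ _)
          simp only [Pi.zero_apply]
          positivity
  have hR2 : 16 / R ^ 2 = 4 / r ^ 2 := by rw [hR]; field_simp; norm_num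
  rw [hR2] at hint
  have : 8 / r ^ 2 = 2 * (4 / r ^ 2) := by ring
  rw [this]
  linarith

/-- If `u` and `m = u - u''` are square integrable, then `u ∈ H¹`, with a bound by `m` alone. -/
theorem integrable_energy {u v w : ℝ → ℂ} (hu : ∀ x, HasDerivAt u (v x) x)
    (hv : ∀ x, HasDerivAt v (w x) x) (hw : Continuous w) (hi : Integrable fun x ↦ ‖u x‖ ^ 2)
    (hm : Integrable fun x ↦ ‖u x - w x‖ ^ 2) :
    Integrable (fun x ↦ ‖u x‖ ^ 2 + ‖v x‖ ^ 2) ∧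
      ∫ x, (‖u x‖ ^ 2 + ‖v x‖ ^ 2) ≤ 2 * ∫ x, ‖u x - w x‖ ^ 2 := by
  have hcu : Continuous u := continuous_iff_continuousAt.2 fun x ↦ (hu x).continuousAt
  have hcv : Continuous v := continuous_iff_continuousAt.2 fun x ↦ (hv x).continuousAt
  have hb : ∀ n : ℕ, ∫ x in -(n + 1 : ℝ)..(n + 1 : ℝ), (‖u x‖ ^ 2 + ‖v x‖ ^ 2) ≤
      2 * (∫ x, ‖u x - w x‖ ^ 2) + 8 / (n + 1 : ℝ) ^ 2 * ∫ x, ‖u x‖ ^ 2 := fun n ↦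
    integral_energy_le hu hv hw hi hm (by positivity)
  have hu0 : 0 ≤ ∫ x, ‖u x‖ ^ 2 := integral_nonneg fun x ↦ by positivity
  have hat : Filter.Tendsto (fun n : ℕ ↦ (n + 1 : ℝ)) Filter.atTop Filter.atTop :=
    Filter.tendsto_atTop_add_const_right _ _ tendsto_natCast_atTop_atTop
  have hab : Filter.Tendsto (fun n : ℕ ↦ -(n + 1 : ℝ)) Filter.atTop Filter.atBot :=
    Filter.tendsto_neg_atTop_atBot.comp hat
  have hint : Integrable (fun x ↦ ‖u x‖ ^ 2 + ‖v x‖ ^ 2) := by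
    refine integrable_of_intervalIntegral_norm_bounded
      (2 * (∫ x, ‖u x - w x‖ ^ 2) + 8 * ∫ x, ‖u x‖ ^ 2) (a := fun n : ℕ ↦ -(n + 1 : ℝ))
      (b := fun n : ℕ ↦ (n + 1 : ℝ)) (l := Filter.atTop) (fun n ↦ ?_) hab hat
      (Filter.Eventually.of_forall fun n ↦ ?_)
    · exact (Continuous.integrableOn_Icc (by fun_prop)).mono_set Set.Ioc_subset_Icc_self
    · have h1 : ∀ x, ‖(‖u x‖ ^ 2 + ‖v x‖ ^ 2)‖ = ‖u x‖ ^ 2 + ‖v x‖ ^ 2 := fun x ↦ by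
        rw [Real.norm_eq_abs, abs_of_nonneg (by positivity)]
      simp only [h1]
      refine (hb n).trans ?_
      gcongr
      refine div_le_self (by norm_num) ?_
      have : (0 : ℝ) ≤ n := n.cast_nonneg
      nlinarith
  refine ⟨hint, ?_⟩
  refine le_of_tendsto_of_tendsto' (intervalIntegral_tendsto_integral hint hab hat)
    (b := Filter.atTop) ?_ hb
  have h2 : Filter.Tendsto (fun n : ℕ ↦ 8 / (n + 1 : ℝ) ^ 2) Filter.atTop (nhds 0) :=
    Filter.Tendsto.const_div_atTop ((Filter.tendsto_pow_atTop two_ne_zero).comp hat) _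
  simpa using (h2.mul_const (∫ x, ‖u x‖ ^ 2)).const_add (2 * (∫ x, ‖u x - w x‖ ^ 2))

/-- Bounds for `f = u ± u'` in `L²` and `L^∞` by the `L²` norm of `m = u - u''`; here `f' = ±(f - m)`
for the respective sign. -/
theorem integrable_and_norm_sq_le_of_sign {u v w : ℝ → ℂ} (hu : ∀ x, HasDerivAt u (v x) x)
    (hv : ∀ x, HasDerivAt v (w x) x) (hw : Continuous w) (hi : Integrable fun x ↦ ‖u x‖ ^ 2)
    (hm : Integrable fun x ↦ ‖u x - w x‖ ^ 2) {σ : ℝ} (hσ : σ = 1 ∨ σ = -1) :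
    Integrable (fun x ↦ ‖u x + σ * v x‖ ^ 2) ∧
      ∫ x, ‖u x + σ * v x‖ ^ 2 ≤ 4 * ∫ x, ‖u x - w x‖ ^ 2 ∧
      ∀ x, ‖u x + σ * v x‖ ^ 2 ≤ 18 * ∫ x, ‖u x - w x‖ ^ 2 := by
  have hcu : Continuous u := continuous_iff_continuousAt.2 fun x ↦ (hu x).continuousAt
  have hcv : Continuous v := continuous_iff_continuousAt.2 fun x ↦ (hv x).continuousAt
  obtain ⟨he, hE⟩ := integrable_energy hu hv hw hi hm
  have hσn : ‖(σ : ℂ)‖ = 1 := by rcases hσ with rfl | rfl <;> simp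
  have hσσ : (σ : ℂ) * σ = 1 := by rcases hσ with rfl | rfl <;> norm_num
  have hsq : ∀ a b : ℂ, ‖a + b‖ ^ 2 ≤ 2 * (‖a‖ ^ 2 + ‖b‖ ^ 2) := fun a b ↦ by
    have := norm_add_le a b
    nlinarith [sq_nonneg (‖a‖ - ‖b‖), norm_nonneg (a + b)]
  have hp : ∀ x, ‖u x + σ * v x‖ ^ 2 ≤ 2 * (‖u x‖ ^ 2 + ‖v x‖ ^ 2) := fun x ↦ by
    have := hsq (u x) (σ * v x)
    rwa [norm_mul, hσn, one_mul] at this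
  have hpi : Integrable (fun x ↦ ‖u x + σ * v x‖ ^ 2) :=
    (he.const_mul 2).mono' (Continuous.aestronglyMeasurable (by fun_prop))
      (Filter.Eventually.of_forall fun x ↦ by
        rw [Real.norm_eq_abs, abs_of_nonneg (by positivity)]; exact hp x)
  have hpI : ∫ x, ‖u x + σ * v x‖ ^ 2 ≤ 4 * ∫ x, ‖u x - w x‖ ^ 2 := by
    have := integral_mono hpi (he.const_mul 2) hp
    rw [integral_const_mul] at this
    linarith
  have hq : ∀ x, ‖v x + σ * w x‖ ^ 2 ≤ 2 * (‖u x + σ * v x‖ ^ 2 + ‖u x - w x‖ ^ 2) := fun x ↦ by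
    have h1 : v x + σ * w x = σ * ((u x + σ * v x) + (-(u x - w x))) := by
      linear_combination (-(v x)) * hσσ
    rw [h1, norm_mul, hσn, one_mul, ← norm_neg (u x - w x)]
    exact hsq _ _
  have hqi : Integrable (fun x ↦ ‖v x + σ * w x‖ ^ 2) :=
    ((hpi.add hm).const_mul 2).mono' (Continuous.aestronglyMeasurable (by fun_prop))
      (Filter.Eventually.of_forall fun x ↦ by
        rw [Real.norm_eq_abs, abs_of_nonneg (by positivity)]; exact hq x)
  have hqI : ∫ x, ‖v x + σ * w x‖ ^ 2 ≤ 10 * ∫ x, ‖u x - w x‖ ^ 2 := by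
    have := integral_mono hqi ((hpi.add hm).const_mul 2) hq
    rw [integral_const_mul, integral_add' hpi hm] at this
    linarith
  refine ⟨hpi, hpI, fun x ↦ ?_⟩
  have := norm_sq_le_of_hasDerivAt (fun x ↦ (hu x).add ((hv x).const_mul (σ : ℂ)))
    (by fun_prop) hpi hqi x
  simp only [Pi.add_apply] at this
  linarith

/-! ### Mollification of a transport equation -/

/-- The average `∫ k(z) f(x - ε z) dz` of `f` at scale `ε` around `x`, for a kernel `k` supported in
`[-1, 1]`. In contrast to a convolution with `ε⁻¹ k(· / ε)`, it is defined and continuous in `ε` up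
to `ε = 0`, where it is `(∫ k) f(x)`. -/
noncomputable def mollify (k : ℝ → ℝ) (f : ℝ → ℂ) (ε x : ℝ) : ℂ :=
  ∫ z in (-1 : ℝ)..1, (k z : ℂ) * f (x - ε * z)

theorem continuous_mollify {k : ℝ → ℝ} (hk : Continuous k) {f : ℝ → ℝ → ℂ}
    (hf : Continuous fun p : ℝ × ℝ ↦ f p.1 p.2) :
    Continuous fun p : ℝ × ℝ × ℝ ↦ mollify k (f p.2.1) p.1 p.2.2 := by
  refine intervalIntegral.continuous_parametric_intervalIntegral_of_continuous' ?_ _ _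
  have : Continuous fun q : (ℝ × ℝ × ℝ) × ℝ ↦ f q.1.2.1 (q.1.2.2 - q.1.1 * q.2) :=
    hf.comp (f := fun q : (ℝ × ℝ × ℝ) × ℝ ↦ (q.1.2.1, q.1.2.2 - q.1.1 * q.2)) (by fun_prop)
  exact (Complex.continuous_ofReal.comp (hk.comp continuous_snd)).mul this

theorem mollify_eq_integral {k : ℝ → ℝ} (hk0 : ∀ z, 1 ≤ |z| → k z = 0) (f : ℝ → ℂ) {ε : ℝ}
    (hε : 0 < ε) (x : ℝ) :
    mollify k f ε x = ∫ y, f y * ((ε⁻¹ * k (ε⁻¹ * (x - y)) : ℝ) : ℂ) := by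
  have hsupp : (Function.support fun z ↦ (k z : ℂ) * f (x - ε * z)) ⊆ Set.Ioc (-1) 1 := by
    intro z hz
    have h1 : ¬ 1 ≤ |z| := fun h ↦ hz (by simp [hk0 z h])
    have h2 := abs_lt.1 (not_le.1 h1)
    exact ⟨h2.1, h2.2.le⟩
  rw [mollify, intervalIntegral.integral_eq_integral_of_support_subset hsupp]
  rw [← integral_sub_left_eq_self (fun y ↦ f y * ((ε⁻¹ * k (ε⁻¹ * (x - y)) : ℝ) : ℂ)) volume x]
  have h3 := Measure.integral_comp_mul_left
    (fun y ↦ f (x - y) * ((ε⁻¹ * k (ε⁻¹ * (x - (x - y))) : ℝ) : ℂ)) ε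
  have h4 : |ε⁻¹| = ε⁻¹ := abs_of_pos (by positivity)
  have h5 : ∫ y, f (x - y) * ((ε⁻¹ * k (ε⁻¹ * (x - (x - y))) : ℝ) : ℂ) =
      ε • ∫ z, f (x - ε * z) * ((ε⁻¹ * k (ε⁻¹ * (x - (x - ε * z))) : ℝ) : ℂ) := by
    rw [h3, h4, smul_smul, mul_inv_cancel₀ hε.ne', one_smul]
  rw [h5, ← integral_smul]
  refine integral_congr_ae (Filter.Eventually.of_forall fun z ↦ ?_)
  have h6 : ε⁻¹ * (x - (x - ε * z)) = z := by field_simp; ring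
  simp only [h6, Complex.real_smul]
  push_cast
  have : (ε : ℂ) ≠ 0 := by exact_mod_cast hε.ne'
  field_simp

theorem hasCompactSupport_scaled_kernel {k : ℝ → ℝ} (hk0 : ∀ z, 1 ≤ |z| → k z = 0) {ε : ℝ}
    (hε : 0 < ε) (x : ℝ) : HasCompactSupport fun y ↦ ε⁻¹ * k (ε⁻¹ * (x - y)) := by
  refine HasCompactSupport.of_support_subset_isCompact (isCompact_Icc (a := x - ε) (b := x + ε))
    fun y hy ↦ ?_
  have h1 : ¬ 1 ≤ |ε⁻¹ * (x - y)| := fun h ↦ hy (by simp [hk0 _ h])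
  rw [not_le, abs_mul, abs_of_pos (inv_pos.2 hε), inv_mul_lt_iff₀ hε, mul_one, abs_lt] at h1
  exact ⟨by linarith, by linarith⟩

theorem hasDerivAt_mollify {η : ℝ → ℝ} (hη : ContDiff ℝ (⊤ : ℕ∞) η)
    (hη0 : ∀ z, 1 ≤ |z| → η z = 0) (hη0' : ∀ z, 1 ≤ |z| → deriv η z = 0)
    {f : ℝ → ℂ} (hf : Continuous f) {ε : ℝ} (hε : 0 < ε) (x : ℝ) :
    HasDerivAt (mollify η f ε) ((ε⁻¹ : ℝ) * mollify (deriv η) f ε x) x := by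
  set g : ℝ → ℝ := fun y ↦ ε⁻¹ * η (ε⁻¹ * y) with hg
  have hgd : ContDiff ℝ 1 g := by
    have : ContDiff ℝ 1 η := hη.of_le (by exact_mod_cast le_top)
    fun_prop
  have hgs : HasCompactSupport g := by
    have := (hasCompactSupport_scaled_kernel hη0 hε 0).comp_homeomorph (Homeomorph.neg ℝ)
    refine this.mono' (subset_closure.trans' ?_)
    intro y hy
    simpa [hg] using hy
  have hderiv : ∀ y, deriv g y = ε⁻¹ * (ε⁻¹ * deriv η (ε⁻¹ * y)) := fun y ↦ by
    have h1 : HasDerivAt η (deriv η (ε⁻¹ * y)) (ε⁻¹ * y) :=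
      (hη.differentiable (by simp)).differentiableAt.hasDerivAt
    have h2 := ((h1.comp y ((hasDerivAt_id y).const_mul ε⁻¹)).const_mul ε⁻¹).deriv
    simp only [hg]
    refine Eq.trans ?_ (h2.trans ?_)
    · rfl
    · ring
  have h := hgs.hasDerivAt_convolution_right (ContinuousLinearMap.lsmul ℝ ℝ).flip
    (hf.locallyIntegrable (μ := volume)) hgd x
  have e1 : convolution f g (ContinuousLinearMap.lsmul ℝ ℝ).flip volume = mollify η f ε := by
    funext y
    rw [mollify_eq_integral hη0 f hε, convolution_def]
    refine integral_congr_ae (Filter.Eventually.of_forall fun t ↦ ?_)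
    simp [hg, mul_comm]
  have e2 : convolution f (deriv g) (ContinuousLinearMap.lsmul ℝ ℝ).flip volume x =
      (ε⁻¹ : ℝ) * mollify (deriv η) f ε x := by
    rw [mollify_eq_integral hη0' f hε, convolution_def, ← integral_const_mul]
    refine integral_congr_ae (Filter.Eventually.of_forall fun t ↦ ?_)
    simp only [ContinuousLinearMap.flip_apply, ContinuousLinearMap.lsmul_apply, hderiv,
      Complex.real_smul]
    push_cast
    ring
  rwa [e1, e2] at h

/-- The commutator of mollification with the transport operator `m ↦ -(J m)_x + i ω m`, with the
difference quotient of `J` written as an average of `J_x`, so that the expression is continuous up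
to `ε = 0`. -/
noncomputable def commutator (η : ℝ → ℝ) (m : ℝ → ℂ) (Jx ω : ℝ → ℝ) (ε x : ℝ) : ℂ :=
  (∫ z in (-1 : ℝ)..1,
    (((∫ s in (0 : ℝ)..1, Jx (x - s * (ε * z))) * z * deriv η z : ℝ) : ℂ) * m (x - ε * z)) +
  Jx x * mollify η m ε x +
  Complex.I * (mollify η (fun y ↦ ω y * m y) ε x - ω x * mollify η m ε x)

theorem continuous_commutator {η : ℝ → ℝ} (hη : ContDiff ℝ (⊤ : ℕ∞) η) {m : ℝ → ℝ → ℂ}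
    {Jx ω : ℝ → ℝ → ℝ} (hm : Continuous fun p : ℝ × ℝ ↦ m p.1 p.2)
    (hJx : Continuous fun p : ℝ × ℝ ↦ Jx p.1 p.2) (hω : Continuous fun p : ℝ × ℝ ↦ ω p.1 p.2) :
    Continuous fun p : ℝ × ℝ × ℝ ↦ commutator η (m p.2.1) (Jx p.2.1) (ω p.2.1) p.1 p.2.2 := by
  have hηc : Continuous η := hη.continuous
  have hηd : Continuous (deriv η) := hη.continuous_deriv (by simp)
  have h0 : Continuous fun q : (ℝ × ℝ × ℝ) × ℝ ↦
      ∫ s in (0 : ℝ)..1, Jx q.1.2.1 (q.1.2.2 - s * (q.1.1 * q.2)) := by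
    refine intervalIntegral.continuous_parametric_intervalIntegral_of_continuous' ?_ _ _
    exact hJx.comp (f := fun r : ((ℝ × ℝ × ℝ) × ℝ) × ℝ ↦
      (r.1.1.2.1, r.1.1.2.2 - r.2 * (r.1.1.1 * r.1.2))) (by fun_prop)
  have h0' : Continuous fun q : (ℝ × ℝ × ℝ) × ℝ ↦ m q.1.2.1 (q.1.2.2 - q.1.1 * q.2) :=
    hm.comp (f := fun q : (ℝ × ℝ × ℝ) × ℝ ↦ (q.1.2.1, q.1.2.2 - q.1.1 * q.2)) (by fun_prop)
  have h1 : Continuous fun p : ℝ × ℝ × ℝ ↦ ∫ z in (-1 : ℝ)..1,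
      (((∫ s in (0 : ℝ)..1, Jx p.2.1 (p.2.2 - s * (p.1 * z))) * z * deriv η z : ℝ) : ℂ) *
        m p.2.1 (p.2.2 - p.1 * z) := by
    refine intervalIntegral.continuous_parametric_intervalIntegral_of_continuous' ?_ _ _
    exact (Complex.continuous_ofReal.comp
      ((h0.mul continuous_snd).mul (hηd.comp continuous_snd))).mul h0'
  have h2 := continuous_mollify hηc hm
  have h3 := continuous_mollify hηc (f := fun τ y ↦ ω τ y * m τ y)
    ((Complex.continuous_ofReal.comp hω).mul hm)
  have h4 : Continuous fun p : ℝ × ℝ × ℝ ↦ (Jx p.2.1 p.2.2 : ℂ) :=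
    Complex.continuous_ofReal.comp (hJx.comp continuous_snd)
  have h5 : Continuous fun p : ℝ × ℝ × ℝ ↦ (ω p.2.1 p.2.2 : ℂ) :=
    Complex.continuous_ofReal.comp (hω.comp continuous_snd)
  exact (h1.add (h4.mul h2)).add (continuous_const.mul (h3.sub (h5.mul h2)))

/-- The commutator vanishes at scale `0`, because `∫ z η'(z) dz = -∫ η`. -/
theorem commutator_zero {η : ℝ → ℝ} (hη : ContDiff ℝ (⊤ : ℕ∞) η)
    (hη0 : ∀ z, 1 ≤ |z| → η z = 0) (m : ℝ → ℂ) (Jx ω : ℝ → ℝ) (x : ℝ) :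
    commutator η m Jx ω 0 x = 0 := by
  have hηd : Continuous (deriv η) := hη.continuous_deriv (by simp)
  have hI : ∫ z in (-1 : ℝ)..1, z * deriv η z = -∫ z in (-1 : ℝ)..1, η z := by
    have := intervalIntegral.integral_mul_deriv_eq_deriv_mul (a := -1) (b := 1)
      (u := fun z : ℝ ↦ z) (u' := fun _ ↦ 1) (v := η) (v' := deriv η)
      (fun z _ ↦ hasDerivAt_id z)
      (fun z _ ↦ (hη.differentiable (by simp)).differentiableAt.hasDerivAt)
      (by simp) (hηd.intervalIntegrable _ _)
    rw [this, hη0 1 (by simp), hη0 (-1) (by simp)]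
    simp
  have hM : ∀ f : ℝ → ℂ, mollify η f 0 x = ((∫ z in (-1 : ℝ)..1, η z : ℝ) : ℂ) * f x := fun f ↦ by
    simp only [mollify, zero_mul, sub_zero]
    rw [intervalIntegral.integral_mul_const, intervalIntegral.integral_ofReal]
  have hK : ∫ z in (-1 : ℝ)..1,
      (((∫ s in (0 : ℝ)..1, Jx (x - s * (0 * z))) * z * deriv η z : ℝ) : ℂ) * m (x - 0 * z) =
      -((∫ z in (-1 : ℝ)..1, η z : ℝ) : ℂ) * Jx x * m x := by
    simp only [zero_mul, mul_zero, sub_zero, intervalIntegral.integral_const, one_smul]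
    rw [intervalIntegral.integral_mul_const, intervalIntegral.integral_ofReal]
    simp only [mul_assoc]
    rw [intervalIntegral.integral_const_mul, hI]
    push_cast
    ring
  rw [commutator, hK, hM, hM]
  ring

/-- The mollified transport operator is the transport operator of the mollification, up to the
commutator. -/
theorem mollify_transport_eq {η : ℝ → ℝ} (hη : ContDiff ℝ (⊤ : ℕ∞) η) {m : ℝ → ℂ}
    {J Jx ω : ℝ → ℝ} (hm : Continuous m) (hJ : ∀ x, HasDerivAt J (Jx x) x) (hJx : Continuous Jx)
    {ε : ℝ} (hε : 0 < ε) (x : ℝ) :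
    -((ε⁻¹ : ℝ) * mollify (deriv η) (fun y ↦ J y * m y) ε x) +
        Complex.I * mollify η (fun y ↦ ω y * m y) ε x =
      -(J x * ((ε⁻¹ : ℝ) * mollify (deriv η) m ε x)) - Jx x * mollify η m ε x +
        Complex.I * (ω x * mollify η m ε x) + commutator η m Jx ω ε x := by
  have hηd : Continuous (deriv η) := hη.continuous_deriv (by simp)
  have hJc : Continuous J := continuous_iff_continuousAt.2 fun x ↦ (hJ x).continuousAt
  have hdiff : ∀ z, (∫ s in (0 : ℝ)..1, Jx (x - s * (ε * z))) * z =
      ε⁻¹ * (J x - J (x - ε * z)) := fun z ↦ by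
    have h1 : ∀ s ∈ Set.uIcc (0 : ℝ) 1, HasDerivAt (fun s ↦ -J (x - s * (ε * z)))
        (Jx (x - s * (ε * z)) * (ε * z)) s := fun s _ ↦ by
      have h2 := ((hJ (x - s * (ε * z))).comp s
        (((hasDerivAt_id s).mul_const (ε * z)).const_sub x)).neg
      refine h2.congr_deriv ?_
      simp
    have h3 := intervalIntegral.integral_eq_sub_of_hasDerivAt h1
      (Continuous.intervalIntegrable (by fun_prop) _ _)
    rw [intervalIntegral.integral_mul_const] at h3
    simp only [one_mul, zero_mul, sub_zero] at h3
    have h4 : (∫ s in (0 : ℝ)..1, Jx (x - s * (ε * z))) * z * ε = J x - J (x - ε * z) := by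
      linear_combination h3
    rw [← h4, mul_comm _ ε, inv_mul_cancel_left₀ hε.ne']
  have hK : ∫ z in (-1 : ℝ)..1,
      (((∫ s in (0 : ℝ)..1, Jx (x - s * (ε * z))) * z * deriv η z : ℝ) : ℂ) * m (x - ε * z) =
      J x * ((ε⁻¹ : ℝ) * mollify (deriv η) m ε x) -
        (ε⁻¹ : ℝ) * mollify (deriv η) (fun y ↦ J y * m y) ε x := by
    simp only [mollify, hdiff]
    rw [← intervalIntegral.integral_const_mul, ← intervalIntegral.integral_const_mul,
      ← intervalIntegral.integral_const_mul, ← intervalIntegral.integral_sub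
        (Continuous.intervalIntegrable (by fun_prop) _ _)
        (Continuous.intervalIntegrable (by fun_prop) _ _)]
    refine intervalIntegral.integral_congr fun z _ ↦ ?_
    push_cast
    ring
  rw [commutator, hK]
  ring

/-- If `m` solves `m_t + (J m)_x - i ω m = 0` in the sense of distributions, then its mollification
is differentiable in time. -/
theorem hasDerivAt_mollify_time {η : ℝ → ℝ} (hη : ContDiff ℝ (⊤ : ℕ∞) η)
    (hη0 : ∀ z, 1 ≤ |z| → η z = 0) (hη0' : ∀ z, 1 ≤ |z| → deriv η z = 0)
    {m : ℝ → ℝ → ℂ} {J ω : ℝ → ℝ} {τ : ℝ}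
    (hweak : ∀ φ : ℝ → ℝ, ContDiff ℝ (⊤ : ℕ∞) φ → HasCompactSupport φ →
      HasDerivAt (fun σ ↦ ∫ y, m σ y * (φ y : ℂ))
        ((∫ y, J y * m τ y * ((deriv φ y : ℝ) : ℂ)) + ∫ y, Complex.I * ω y * m τ y * (φ y : ℂ)) τ)
    {ε : ℝ} (hε : 0 < ε) (x : ℝ) :
    HasDerivAt (fun σ ↦ mollify η (m σ) ε x)
      (-((ε⁻¹ : ℝ) * mollify (deriv η) (fun y ↦ J y * m τ y) ε x) +
        Complex.I * mollify η (fun y ↦ ω y * m τ y) ε x) τ := by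
  have h := hweak (fun y ↦ ε⁻¹ * η (ε⁻¹ * (x - y))) (by fun_prop)
    (hasCompactSupport_scaled_kernel hη0 hε x)
  have hderiv : ∀ y, deriv (fun y ↦ ε⁻¹ * η (ε⁻¹ * (x - y))) y =
      -(ε⁻¹ * (ε⁻¹ * deriv η (ε⁻¹ * (x - y)))) := fun y ↦ by
    have h1 : HasDerivAt η (deriv η (ε⁻¹ * (x - y))) (ε⁻¹ * (x - y)) :=
      (hη.differentiable (by simp)).differentiableAt.hasDerivAt
    have h2 := ((h1.comp y (((hasDerivAt_id y).const_sub x).const_mul ε⁻¹)).const_mul ε⁻¹).deriv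
    refine Eq.trans ?_ (h2.trans ?_)
    · rfl
    · ring
  have e0 : (fun σ ↦ mollify η (m σ) ε x) =
      fun σ ↦ ∫ y, m σ y * ((ε⁻¹ * η (ε⁻¹ * (x - y)) : ℝ) : ℂ) :=
    funext fun σ ↦ mollify_eq_integral hη0 (m σ) hε x
  rw [e0, mollify_eq_integral hη0' _ hε, mollify_eq_integral hη0 _ hε]
  refine h.congr_deriv ?_
  rw [← integral_const_mul, ← integral_const_mul, ← integral_neg]
  congr 1
  · refine integral_congr_ae (Filter.Eventually.of_forall fun y ↦ ?_)
    simp only [hderiv]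
    push_cast
    ring
  · refine integral_congr_ae (Filter.Eventually.of_forall fun y ↦ ?_)
    simp only
    ring

/-! ### The modulus of a solution of a transport equation -/

/-- The regularized modulus `√(|z|² + ε²)`. -/
noncomputable def regAbs (ε : ℝ) (z : ℂ) : ℝ := √(‖z‖ ^ 2 + ε ^ 2)

theorem continuous_regAbs : Continuous fun p : ℝ × ℂ ↦ regAbs p.1 p.2 := by
  unfold regAbs
  fun_prop

theorem regAbs_zero (z : ℂ) : regAbs 0 z = ‖z‖ := by
  simp [regAbs]

theorem regAbs_pos {ε : ℝ} (hε : 0 < ε) (z : ℂ) : 0 < regAbs ε z :=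
  Real.sqrt_pos.2 (by positivity)

theorem regAbs_sq (ε : ℝ) (z : ℂ) : regAbs ε z ^ 2 = ‖z‖ ^ 2 + ε ^ 2 :=
  Real.sq_sqrt (by positivity)

theorem norm_le_regAbs (ε : ℝ) (z : ℂ) : ‖z‖ ≤ regAbs ε z :=
  Real.le_sqrt_of_sq_le (by nlinarith [sq_nonneg ε])

theorem le_regAbs (ε : ℝ) (z : ℂ) : ε ≤ regAbs ε z :=
  Real.le_sqrt_of_sq_le (by nlinarith [sq_nonneg ‖z‖])

theorem hasDerivAt_regAbs {ε : ℝ} (hε : 0 < ε) {f : ℝ → ℂ} {f' : ℂ} {x : ℝ}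
    (hf : HasDerivAt f f' x) :
    HasDerivAt (fun y ↦ regAbs ε (f y)) (inner ℝ (f x) f' / regAbs ε (f x)) x := by
  have h := (hf.norm_sq.add_const (ε ^ 2)).sqrt (by positivity)
  refine h.congr_deriv ?_
  rw [mul_div_mul_left _ _ two_ne_zero]
  rfl

/-- If `D = -(J M)_x + i ω M + r`, then the regularized modulus of `M` is transported by `J` up to
terms controlled by `r` and by the regularization: the phase term is orthogonal to `M`, and the
divergence `(J χ |M|)_x` integrates to zero. -/
theorem abs_integral_inner_div_le {M M' D r : ℝ → ℂ} {J Jx ω χ χ' : ℝ → ℝ} {ε R : ℝ} (hε : 0 < ε)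
    (hR : 0 ≤ R) (hM : ∀ x, HasDerivAt M (M' x) x) (hJ : ∀ x, HasDerivAt J (Jx x) x)
    (hχ : ∀ x, HasDerivAt χ (χ' x) x) (hM' : Continuous M') (hJx : Continuous Jx)
    (hχ' : Continuous χ') (hr : Continuous r) (hχR : χ R = 0) (hχR' : χ (-R) = 0)
    (hD : ∀ x, D x = -(J x * M' x) - Jx x * M x + Complex.I * (ω x * M x) + r x) :
    |∫ x in -R..R, inner ℝ (M x) (D x) / regAbs ε (M x) * χ x| ≤
      ∫ x in -R..R, (regAbs ε (M x) * |J x| * |χ' x| + ε * |Jx x| * |χ x| + ‖r x‖ * |χ x|) := by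
  have hMc : Continuous M := continuous_iff_continuousAt.2 fun x ↦ (hM x).continuousAt
  have hJc : Continuous J := continuous_iff_continuousAt.2 fun x ↦ (hJ x).continuousAt
  have hχc : Continuous χ := continuous_iff_continuousAt.2 fun x ↦ (hχ x).continuousAt
  have hb : Continuous fun x ↦ regAbs ε (M x) :=
    continuous_regAbs.comp (f := fun x ↦ (ε, M x)) (by fun_prop)
  have hb0 : ∀ x, regAbs ε (M x) ≠ 0 := fun x ↦ (regAbs_pos hε _).ne'
  set G' : ℝ → ℝ := fun x ↦ inner ℝ (M x) (M' x) / regAbs ε (M x) * (J x * χ x) +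
    regAbs ε (M x) * (Jx x * χ x + J x * χ' x) with hG'
  have hGd : ∀ x, HasDerivAt (fun x ↦ regAbs ε (M x) * (J x * χ x)) (G' x) x := fun x ↦
    (hasDerivAt_regAbs hε (hM x)).mul ((hJ x).mul (hχ x))
  have hG'c : Continuous G' := by
    have : Continuous fun x ↦ inner ℝ (M x) (M' x) / regAbs ε (M x) :=
      Continuous.div (by fun_prop) hb hb0
    fun_prop
  have hG0 : ∫ x in -R..R, G' x = 0 := by
    rw [intervalIntegral.integral_eq_sub_of_hasDerivAt (fun x _ ↦ hGd x)
      (hG'c.intervalIntegrable _ _), hχR, hχR']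
    simp
  set E : ℝ → ℝ := fun x ↦ regAbs ε (M x) * (J x * χ' x) +
    ε ^ 2 / regAbs ε (M x) * (Jx x * χ x) + inner ℝ (M x) (r x) / regAbs ε (M x) * χ x with hE
  have hEc : Continuous E := by
    have h1 : Continuous fun x ↦ inner ℝ (M x) (r x) / regAbs ε (M x) :=
      Continuous.div (by fun_prop) hb hb0
    have h2 : Continuous fun x ↦ ε ^ 2 / regAbs ε (M x) := Continuous.div (by fun_prop) hb hb0
    fun_prop
  have hsplit : ∀ x, inner ℝ (M x) (D x) / regAbs ε (M x) * χ x = E x - G' x := fun x ↦ by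
    have h1 : inner ℝ (M x) (D x) = -(J x * inner ℝ (M x) (M' x)) - Jx x * ‖M x‖ ^ 2 +
        inner ℝ (M x) (r x) := by
      rw [hD, ← real_inner_self_eq_norm_sq]
      simp only [Complex.inner, Complex.mul_re, Complex.mul_im, Complex.conj_re, Complex.conj_im,
        Complex.add_re, Complex.add_im, Complex.sub_re, Complex.sub_im, Complex.neg_re,
        Complex.neg_im, Complex.I_re, Complex.I_im, Complex.ofReal_re, Complex.ofReal_im]
      ring
    have h2 := regAbs_sq ε (M x)
    have h3 := hb0 x
    rw [h1]
    simp only [hE, hG']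
    field_simp
    linear_combination (Jx x * χ x) * h2
  have hEb : ∀ x, ‖E x‖ ≤
      regAbs ε (M x) * |J x| * |χ' x| + ε * |Jx x| * |χ x| + ‖r x‖ * |χ x| := fun x ↦ by
    have hp := regAbs_pos hε (M x)
    refine (norm_add₃_le).trans (add_le_add (add_le_add (le_of_eq ?_) ?_) ?_)
    · rw [norm_mul, norm_mul, Real.norm_of_nonneg hp.le, Real.norm_eq_abs, Real.norm_eq_abs,
        mul_assoc]
    · rw [norm_mul, norm_mul, Real.norm_of_nonneg (by positivity), Real.norm_eq_abs,
        Real.norm_eq_abs, mul_assoc]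
      refine mul_le_mul_of_nonneg_right ?_ (by positivity)
      rw [div_le_iff₀ hp, sq]
      exact mul_le_mul_of_nonneg_left (le_regAbs _ _) hε.le
    · rw [norm_mul, norm_div, Real.norm_of_nonneg hp.le, Real.norm_eq_abs, Real.norm_eq_abs]
      refine mul_le_mul_of_nonneg_right ?_ (abs_nonneg _)
      rw [div_le_iff₀ hp]
      calc _ ≤ ‖M x‖ * ‖r x‖ := abs_real_inner_le_norm _ _
        _ ≤ regAbs ε (M x) * ‖r x‖ :=
          mul_le_mul_of_nonneg_right (norm_le_regAbs _ _) (norm_nonneg _)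
        _ = _ := mul_comm _ _
  simp only [hsplit]
  rw [intervalIntegral.integral_sub (hEc.intervalIntegrable _ _) (hG'c.intervalIntegrable _ _),
    hG0, sub_zero, ← Real.norm_eq_abs]
  exact intervalIntegral.norm_integral_le_of_norm_le (by linarith)
    (Filter.Eventually.of_forall fun x _ ↦ hEb x) (Continuous.intervalIntegrable (by fun_prop) _ _)

theorem exists_mollifier : ∃ η : ℝ → ℝ, ContDiff ℝ (⊤ : ℕ∞) η ∧ (∀ z, 1 ≤ |z| → η z = 0) ∧
    (∀ z, 1 ≤ |z| → deriv η z = 0) ∧ ∫ z in (-1 : ℝ)..1, η z = 1 := by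
  let b : ContDiffBump (0 : ℝ) := ⟨1 / 4, 1 / 2, by norm_num, by norm_num⟩
  have h0 : ∀ z : ℝ, 1 / 2 ≤ |z| → b.normed volume z = 0 := fun z hz ↦ by
    rw [← Function.notMem_support, b.support_normed_eq]
    simpa [b] using hz
  refine ⟨b.normed volume, b.contDiff_normed, fun z hz ↦ h0 z (by linarith), fun z hz ↦ ?_, ?_⟩
  · have : b.normed volume =ᶠ[nhds z] fun _ ↦ 0 := by
      have hmem : {y : ℝ | 1 / 2 < |y|} ∈ nhds z :=
        (isOpen_lt continuous_const continuous_abs).mem_nhds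
          (by simp only [Set.mem_ofPred_eq]; linarith)
      filter_upwards [hmem] with y hy using h0 y (le_of_lt hy)
    rw [this.deriv_eq, deriv_const]
  · rw [intervalIntegral.integral_eq_integral_of_support_subset, b.integral_normed]
    intro z hz
    have h1 : ¬ 1 / 2 ≤ |z| := fun h ↦ hz (h0 z h)
    have h2 := abs_lt.1 (not_le.1 h1)
    exact ⟨by linarith, by linarith⟩

/-- Localized conservation of `∫ |m|` for distributional solutions of
`m_t + (J m)_x - i ω m = 0` with continuous `m`, `J`, `J_x` and `ω`: against a weight `χ` vanishing
at `± R`, the integral changes at most by the flux `∫ |m| |J| |χ'|`. -/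
theorem abs_integral_norm_sub_le {m : ℝ → ℝ → ℂ} {J Jx ω : ℝ → ℝ → ℝ} {χ χ' : ℝ → ℝ} {t R A : ℝ}
    (ht : 0 < t) (hR : 0 ≤ R)
    (hm : Continuous fun p : ℝ × ℝ ↦ m p.1 p.2) (hJ : Continuous fun p : ℝ × ℝ ↦ J p.1 p.2)
    (hJx : Continuous fun p : ℝ × ℝ ↦ Jx p.1 p.2) (hω : Continuous fun p : ℝ × ℝ ↦ ω p.1 p.2)
    (hJd : ∀ τ x, HasDerivAt (J τ) (Jx τ x) x)
    (hweak : ∀ τ ∈ Set.Ioo 0 t, ∀ φ : ℝ → ℝ, ContDiff ℝ (⊤ : ℕ∞) φ → HasCompactSupport φ →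
      HasDerivAt (fun σ ↦ ∫ y, m σ y * (φ y : ℂ))
        ((∫ y, J τ y * m τ y * ((deriv φ y : ℝ) : ℂ)) +
          ∫ y, Complex.I * ω τ y * m τ y * (φ y : ℂ)) τ)
    (hχ : ∀ x, HasDerivAt χ (χ' x) x) (hχ' : Continuous χ') (hχR : χ R = 0) (hχR' : χ (-R) = 0)
    (hA : ∀ τ ∈ Set.Icc 0 t, ∫ x in -R..R, ‖m τ x‖ * |J τ x| * |χ' x| ≤ A) :
    |(∫ x in -R..R, ‖m t x‖ * χ x) - ∫ x in -R..R, ‖m 0 x‖ * χ x| ≤ A * t := by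
  obtain ⟨η, hη, hη0, hη0', hη1⟩ := exists_mollifier
  have hηd : Continuous (deriv η) := hη.continuous_deriv (by simp)
  have hχc : Continuous χ := continuous_iff_continuousAt.2 fun x ↦ (hχ x).continuousAt
  have hMc : Continuous fun p : ℝ × ℝ × ℝ ↦ mollify η (m p.2.1) p.1 p.2.2 :=
    continuous_mollify hη.continuous hm
  have hβc : Continuous fun p : ℝ × ℝ × ℝ ↦ regAbs p.1 (mollify η (m p.2.1) p.1 p.2.2) :=
    continuous_regAbs.comp (f := fun p : ℝ × ℝ × ℝ ↦ (p.1, mollify η (m p.2.1) p.1 p.2.2))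
      (continuous_fst.prodMk hMc)
  have hrc := continuous_commutator hη hm hJx hω
  have hM0 : ∀ τ x, mollify η (m τ) 0 x = m τ x := fun τ x ↦ by
    simp only [mollify, zero_mul, sub_zero]
    rw [intervalIntegral.integral_mul_const, intervalIntegral.integral_ofReal, hη1]
    simp
  have hslice : ∀ {g : ℝ → ℝ → ℝ}, Continuous (fun p : ℝ × ℝ ↦ g p.1 p.2) → ∀ τ, Continuous (g τ) :=
    fun hg τ ↦ hg.comp (f := fun x : ℝ ↦ (τ, x)) (by fun_prop)
  -- The regularized weighted modulus, and the bound for its time derivative, both continuous up to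
  -- the scale `ε = 0`.
  set h : ℝ → ℝ → ℝ := fun ε τ ↦ ∫ x in -R..R, regAbs ε (mollify η (m τ) ε x) * χ x with hh
  set B : ℝ → ℝ → ℝ := fun ε τ ↦ ∫ x in -R..R,
    (regAbs ε (mollify η (m τ) ε x) * |J τ x| * |χ' x| + ε * |Jx τ x| * |χ x| +
      ‖commutator η (m τ) (Jx τ) (ω τ) ε x‖ * |χ x|) with hB
  have hhc : Continuous fun p : ℝ × ℝ ↦ h p.1 p.2 := by
    refine intervalIntegral.continuous_parametric_intervalIntegral_of_continuous' ?_ _ _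
    have := hβc.comp (f := fun q : (ℝ × ℝ) × ℝ ↦ (q.1.1, q.1.2, q.2)) (by fun_prop)
    exact this.mul (hχc.comp continuous_snd)
  have hBc : Continuous fun p : ℝ × ℝ ↦ B p.1 p.2 := by
    refine intervalIntegral.continuous_parametric_intervalIntegral_of_continuous' ?_ _ _
    have h1 := hβc.comp (f := fun q : (ℝ × ℝ) × ℝ ↦ (q.1.1, q.1.2, q.2)) (by fun_prop)
    have h2 := hrc.comp (f := fun q : (ℝ × ℝ) × ℝ ↦ (q.1.1, q.1.2, q.2)) (by fun_prop)
    have h3 := hJ.comp (f := fun q : (ℝ × ℝ) × ℝ ↦ (q.1.2, q.2)) (by fun_prop)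
    have h4 := hJx.comp (f := fun q : (ℝ × ℝ) × ℝ ↦ (q.1.2, q.2)) (by fun_prop)
    have h5 : Continuous fun q : (ℝ × ℝ) × ℝ ↦ |χ q.2| := (hχc.comp continuous_snd).abs
    exact ((h1.mul h3.abs).mul (hχ'.comp continuous_snd).abs).add
      (((continuous_fst.comp continuous_fst).mul h4.abs).mul h5) |>.add (h2.norm.mul h5)
  have hB0 : ∀ τ ∈ Set.Icc 0 t, B 0 τ ≤ A := fun τ hτ ↦ by
    refine le_of_eq_of_le ?_ (hA τ hτ)
    simp only [hB]
    refine intervalIntegral.integral_congr fun x _ ↦ ?_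
    simp only [hM0, regAbs_zero, commutator_zero hη hη0]
    simp
  have hh0 : ∀ τ, h 0 τ = ∫ x in -R..R, ‖m τ x‖ * χ x := fun τ ↦ by
    simp only [hh, hM0, regAbs_zero]
  -- The time derivative at positive scale.
  have hderiv : ∀ ε > 0, ∀ τ ∈ Set.Ioo 0 t, ∃ d, HasDerivAt (h ε) d τ ∧ |d| ≤ B ε τ := by
    intro ε hε τ hτ
    set D : ℝ → ℝ → ℂ := fun τ x ↦
      -((ε⁻¹ : ℝ) * mollify (deriv η) (fun y ↦ J τ y * m τ y) ε x) +
        Complex.I * mollify η (fun y ↦ ω τ y * m τ y) ε x with hD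
    have hDc : Continuous fun p : ℝ × ℝ ↦ D p.1 p.2 := by
      have h1 := (continuous_mollify hηd (f := fun τ y ↦ J τ y * m τ y)
        ((Complex.continuous_ofReal.comp hJ).mul hm)).comp
        (f := fun p : ℝ × ℝ ↦ (ε, p.1, p.2)) (by fun_prop)
      have h2 := (continuous_mollify hη.continuous (f := fun τ y ↦ ω τ y * m τ y)
        ((Complex.continuous_ofReal.comp hω).mul hm)).comp
        (f := fun p : ℝ × ℝ ↦ (ε, p.1, p.2)) (by fun_prop)
      exact ((continuous_const.mul h1).neg).add (continuous_const.mul h2)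
    have hMc' : Continuous fun p : ℝ × ℝ ↦ mollify η (m p.1) ε p.2 :=
      hMc.comp (f := fun p : ℝ × ℝ ↦ (ε, p.1, p.2)) (by fun_prop)
    have hβc' : Continuous fun p : ℝ × ℝ ↦ regAbs ε (mollify η (m p.1) ε p.2) :=
      hβc.comp (f := fun p : ℝ × ℝ ↦ (ε, p.1, p.2)) (by fun_prop)
    have hF' : Continuous fun p : ℝ × ℝ ↦ inner ℝ (mollify η (m p.1) ε p.2) (D p.1 p.2) /
        regAbs ε (mollify η (m p.1) ε p.2) * χ p.2 :=
      (Continuous.div (hMc'.inner hDc) hβc' fun p ↦ (regAbs_pos hε _).ne').mul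
        (hχc.comp continuous_snd)
    obtain ⟨C, hC⟩ := (isCompact_Icc (a := (0 : ℝ)) (b := t)).prod
      (isCompact_Icc (a := -R) (b := R)) |>.exists_bound_of_continuousOn hF'.continuousOn
    have hFc : ∀ σ, Continuous fun x ↦ regAbs ε (mollify η (m σ) ε x) * χ x := fun σ ↦
      (hβc'.comp (f := fun x : ℝ ↦ (σ, x)) (by fun_prop)).mul hχc
    have key := intervalIntegral.hasDerivAt_integral_of_dominated_loc_of_deriv_le (μ := volume)
      (a := -R) (b := R) (x₀ := τ) (s := Set.Ioo 0 t)
      (F := fun σ x ↦ regAbs ε (mollify η (m σ) ε x) * χ x)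
      (F' := fun σ x ↦ inner ℝ (mollify η (m σ) ε x) (D σ x) /
        regAbs ε (mollify η (m σ) ε x) * χ x) (bound := fun _ ↦ C)
      (Ioo_mem_nhds hτ.1 hτ.2)
      (Filter.Eventually.of_forall fun σ ↦ (hFc σ).aestronglyMeasurable)
      ((hFc τ).intervalIntegrable _ _)
      (hF'.comp (f := fun x : ℝ ↦ (τ, x)) (by fun_prop)).aestronglyMeasurable
      (Filter.Eventually.of_forall fun x hx σ hσ ↦ ?_) (by simp)
      (Filter.Eventually.of_forall fun x _ σ hσ ↦ ?_)
    · refine ⟨_, key.2, ?_⟩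
      refine abs_integral_inner_div_le (M' := fun x ↦ (ε⁻¹ : ℝ) * mollify (deriv η) (m τ) ε x)
        (r := commutator η (m τ) (Jx τ) (ω τ) ε) (ω := ω τ) hε hR
        (hasDerivAt_mollify hη hη0 hη0' (hm.comp (f := fun x : ℝ ↦ (τ, x)) (by fun_prop)) hε)
        (hJd τ) hχ ?_ (hslice hJx τ) hχ' ?_ hχR hχR' fun x ↦ ?_
      · exact continuous_const.mul ((continuous_mollify hηd hm).comp
          (f := fun x : ℝ ↦ (ε, τ, x)) (by fun_prop))
      · exact hrc.comp (f := fun x : ℝ ↦ (ε, τ, x)) (by fun_prop)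
      · exact mollify_transport_eq hη (hm.comp (f := fun x : ℝ ↦ (τ, x)) (by fun_prop)) (hJd τ)
          (hslice hJx τ) hε x
    · rw [Set.uIoc_of_le (by linarith)] at hx
      exact hC (σ, x) ⟨Set.Ioo_subset_Icc_self hσ, Set.Ioc_subset_Icc_self hx⟩
    · exact (hasDerivAt_regAbs hε
        (hasDerivAt_mollify_time hη hη0 hη0' (hweak σ hσ) hε x)).mul_const _
  choose! d hd hdB using hderiv
  -- As `B` is continuous, the bound at scale zero persists uniformly in time at small scales.
  refine le_of_forall_pos_le_add fun κ hκ ↦ ?_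
  have hev : ∀ᶠ ε in nhds (0 : ℝ), ∀ τ ∈ Set.Icc 0 t, B ε τ < A + κ / t :=
    isCompact_Icc.eventually_forall_of_forall_eventually fun τ hτ ↦
      hBc.continuousAt.eventually_lt continuousAt_const
        ((hB0 τ hτ).trans_lt (by linarith [div_pos hκ ht]))
  have hslope : ∀ᶠ ε in nhdsWithin (0 : ℝ) (Set.Ioi 0), |h ε t - h ε 0| ≤ A * t + κ := by
    filter_upwards [nhdsWithin_le_nhds hev, self_mem_nhdsWithin] with ε hε1 hε2
    obtain ⟨c, hc, hc'⟩ := exists_hasDerivAt_eq_slope (h ε) (d ε) ht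
      (hhc.comp (f := fun τ : ℝ ↦ (ε, τ)) (by fun_prop)).continuousOn (fun τ hτ ↦ hd ε hε2 τ hτ)
    have h1 := (hdB ε hε2 c hc).trans (hε1 c (Set.Ioo_subset_Icc_self hc)).le
    rw [hc', sub_zero, abs_div, abs_of_pos ht, div_le_iff₀ ht, add_mul, div_mul_cancel₀ _ ht.ne']
      at h1
    exact h1
  have hlim : Filter.Tendsto (fun ε ↦ |h ε t - h ε 0|) (nhdsWithin (0 : ℝ) (Set.Ioi 0))
      (nhds |h 0 t - h 0 0|) := by
    have hc : Continuous fun ε ↦ |h ε t - h ε 0| :=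
      ((hhc.comp (f := fun ε : ℝ ↦ (ε, t)) (by fun_prop)).sub
        (hhc.comp (f := fun ε : ℝ ↦ (ε, (0 : ℝ))) (by fun_prop))).abs
    exact hc.continuousAt.tendsto.mono_left nhdsWithin_le_nhds
  have := le_of_tendsto hlim hslope
  rwa [hh0, hh0] at this

/-! ### Exhausting the line and estimating the velocity -/

theorem continuous_of_norm_sub_le {E : Type*} [SeminormedAddCommGroup E] {F : ℝ → ℝ → ℂ}
    {G : ℝ → E} {C : ℝ} (hF : ∀ τ, Continuous (F τ)) (hG : Continuous G)
    (h : ∀ τ σ x, ‖F τ x - F σ x‖ ≤ C * ‖G τ - G σ‖) :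
    Continuous fun p : ℝ × ℝ ↦ F p.1 p.2 := by
  refine continuous_iff_continuousAt.2 fun p ↦ ?_
  have h1 : Filter.Tendsto (fun q : ℝ × ℝ ↦ F q.1 q.2 - F p.1 q.2) (nhds p) (nhds 0) := by
    refine squeeze_zero_norm (fun q ↦ h q.1 p.1 q.2) ?_
    have h2 : Continuous fun q : ℝ × ℝ ↦ C * ‖G q.1 - G p.1‖ := by fun_prop
    simpa using h2.tendsto p
  have h3 : Filter.Tendsto (fun q : ℝ × ℝ ↦ F p.1 q.2) (nhds p) (nhds (F p.1 p.2)) :=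
    ((hF p.1).comp continuous_snd).tendsto p
  simpa [ContinuousAt] using h1.add h3

theorem tendsto_integral_weighted {f : ℝ → ℝ} (hf : Continuous f) (hi : Integrable f) :
    Filter.Tendsto
      (fun n : ℕ ↦ ∫ x in -(n + 1 : ℝ)..(n + 1 : ℝ), f x * (1 - x ^ 2 / (n + 1 : ℝ) ^ 2))
      Filter.atTop (nhds (∫ x, f x)) := by
  have hat : Filter.Tendsto (fun n : ℕ ↦ (n + 1 : ℝ)) Filter.atTop Filter.atTop :=
    Filter.tendsto_atTop_add_const_right _ _ tendsto_natCast_atTop_atTop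
  have h1 : ∀ n : ℕ, ∫ x in -(n + 1 : ℝ)..(n + 1 : ℝ), f x * (1 - x ^ 2 / (n + 1 : ℝ) ^ 2) =
      ∫ x, (Set.Ioc (-(n + 1 : ℝ)) (n + 1)).indicator
        (fun x ↦ f x * (1 - x ^ 2 / (n + 1 : ℝ) ^ 2)) x := fun n ↦ by
    rw [intervalIntegral.integral_of_le (by linarith [n.cast_nonneg (α := ℝ)]),
      integral_indicator measurableSet_Ioc]
  simp only [h1]
  refine tendsto_integral_of_dominated_convergence (fun x ↦ ‖f x‖) (fun n ↦ ?_) hi.norm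
    (fun n ↦ Filter.Eventually.of_forall fun x ↦ ?_) (Filter.Eventually.of_forall fun x ↦ ?_)
  · exact (Continuous.aestronglyMeasurable (by fun_prop)).indicator measurableSet_Ioc
  · by_cases hx : x ∈ Set.Ioc (-(n + 1 : ℝ)) (n + 1)
    · rw [Set.indicator_of_mem hx, norm_mul]
      refine mul_le_of_le_one_right (norm_nonneg _) ?_
      have hn : (0 : ℝ) < n + 1 := by positivity
      have h2 : x ^ 2 ≤ (n + 1 : ℝ) ^ 2 := sq_le_sq' hx.1.le hx.2
      have h3 : x ^ 2 / (n + 1 : ℝ) ^ 2 ≤ 1 := div_le_one_of_le₀ h2 (by positivity)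
      have h4 : 0 ≤ x ^ 2 / (n + 1 : ℝ) ^ 2 := by positivity
      rw [Real.norm_eq_abs, abs_of_nonneg (by linarith)]
      linarith
    · rw [Set.indicator_of_notMem hx, norm_zero]
      exact norm_nonneg _
  · have h2 : Filter.Tendsto (fun n : ℕ ↦ f x * (1 - x ^ 2 / (n + 1 : ℝ) ^ 2)) Filter.atTop
        (nhds (f x)) := by
      have h3 : Filter.Tendsto (fun n : ℕ ↦ x ^ 2 / (n + 1 : ℝ) ^ 2) Filter.atTop (nhds 0) :=
        Filter.Tendsto.const_div_atTop ((Filter.tendsto_pow_atTop two_ne_zero).comp hat) _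
      simpa using (h3.const_sub 1).const_mul (f x)
    refine h2.congr' ?_
    filter_upwards [hat.eventually_gt_atTop |x|] with n hn
    have := abs_lt.1 hn
    rw [Set.indicator_of_mem (show x ∈ Set.Ioc (-(n + 1 : ℝ)) (n + 1) from ⟨this.1, this.2.le⟩)]

/-- If the integrals of `f` and of the integrable function `f₀` against the weights `1 - x² / R²` on
`[-R, R]` agree up to `O(1 / R)`, then `f` is integrable with the same integral. -/
theorem integrable_and_integral_eq_of_weighted {f f₀ : ℝ → ℝ} (hf : Continuous f)
    (hf₀ : Continuous f₀) (hpos : ∀ x, 0 ≤ f x) (hpos₀ : ∀ x, 0 ≤ f₀ x) (hi : Integrable f₀) {K : ℝ}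
    (hK : ∀ R > 0, |(∫ x in -R..R, f x * (1 - x ^ 2 / R ^ 2)) -
      ∫ x in -R..R, f₀ x * (1 - x ^ 2 / R ^ 2)| ≤ K / R) :
    Integrable f ∧ ∫ x, f x = ∫ x, f₀ x := by
  have hat : Filter.Tendsto (fun n : ℕ ↦ (n + 1 : ℝ)) Filter.atTop Filter.atTop :=
    Filter.tendsto_atTop_add_const_right _ _ tendsto_natCast_atTop_atTop
  have hab : Filter.Tendsto (fun n : ℕ ↦ -(n + 1 : ℝ)) Filter.atTop Filter.atBot :=
    Filter.tendsto_neg_atTop_atBot.comp hat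
  have hK0 : 0 ≤ K := by
    have := (abs_nonneg _).trans (hK 1 one_pos)
    simpa using this
  have hw : ∀ R : ℝ, 0 < R → ∀ x ∈ Set.Icc (-R) R,
      0 ≤ 1 - x ^ 2 / R ^ 2 ∧ 1 - x ^ 2 / R ^ 2 ≤ 1 := by
    intro R hR x hx
    have h2 : x ^ 2 ≤ R ^ 2 := sq_le_sq' hx.1 hx.2
    have h3 : x ^ 2 / R ^ 2 ≤ 1 := div_le_one_of_le₀ h2 (by positivity)
    have h4 : 0 ≤ x ^ 2 / R ^ 2 := by positivity
    exact ⟨by linarith, by linarith⟩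
  have hfi : Integrable f := by
    refine integrable_of_intervalIntegral_norm_bounded (2 * ((∫ x, f₀ x) + K))
      (a := fun n : ℕ ↦ -(n + 1 : ℝ)) (b := fun n : ℕ ↦ (n + 1 : ℝ)) (l := Filter.atTop)
      (fun n ↦ (Continuous.integrableOn_Icc (by fun_prop)).mono_set Set.Ioc_subset_Icc_self) hab hat
      (Filter.Eventually.of_forall fun n ↦ ?_)
    have hr1 : (1 : ℝ) ≤ n + 1 := by linarith [n.cast_nonneg (α := ℝ)]
    set r : ℝ := n + 1
    have hR : 0 < 2 * r := by linarith
    calc ∫ x in -r..r, ‖f x‖ ≤ ∫ x in -r..r, 2 * (f x * (1 - x ^ 2 / (2 * r) ^ 2)) := by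
          refine intervalIntegral.integral_mono_on (by linarith)
            (Continuous.intervalIntegrable (by fun_prop) _ _)
            (Continuous.intervalIntegrable (by fun_prop) _ _) fun x hx ↦ ?_
          have h2 : x ^ 2 ≤ r ^ 2 := sq_le_sq' hx.1 hx.2
          have h3 : x ^ 2 / (2 * r) ^ 2 ≤ 1 / 2 := by
            rw [div_le_div_iff₀ (by positivity) (by norm_num)]
            nlinarith
          rw [Real.norm_of_nonneg (hpos x)]
          nlinarith [mul_le_mul_of_nonneg_left h3 (hpos x)]
      _ = 2 * ∫ x in -r..r, f x * (1 - x ^ 2 / (2 * r) ^ 2) :=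
          intervalIntegral.integral_const_mul _ _
      _ ≤ 2 * ∫ x in -(2 * r)..2 * r, f x * (1 - x ^ 2 / (2 * r) ^ 2) := by
          refine mul_le_mul_of_nonneg_left ?_ zero_le_two
          refine intervalIntegral.integral_mono_interval (by linarith) (by linarith) (by linarith)
            ?_ (Continuous.intervalIntegrable (by fun_prop) _ _)
          refine (ae_restrict_iff' measurableSet_Ioc).2 (Filter.Eventually.of_forall fun x hx ↦ ?_)
          exact mul_nonneg (hpos x) (hw _ hR x (Set.Ioc_subset_Icc_self hx)).1
      _ ≤ 2 * ((∫ x in -(2 * r)..2 * r, f₀ x * (1 - x ^ 2 / (2 * r) ^ 2)) + K / (2 * r)) := by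
          have := (abs_le.1 (hK _ hR)).2
          linarith
      _ ≤ 2 * ((∫ x, f₀ x) + K) := by
          have h1 : ∫ x in -(2 * r)..2 * r, f₀ x * (1 - x ^ 2 / (2 * r) ^ 2) ≤ ∫ x, f₀ x := by
            refine le_trans (intervalIntegral.integral_mono_on (g := f₀) (by linarith)
              (Continuous.intervalIntegrable (by fun_prop) _ _)
              (Continuous.intervalIntegrable (by fun_prop) _ _) fun x hx ↦
                mul_le_of_le_one_right (hpos₀ x) (hw _ hR x hx).2) ?_
            rw [intervalIntegral.integral_of_le (by linarith)]
            exact setIntegral_le_integral hi (Filter.Eventually.of_forall hpos₀)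
          have h2 : K / (2 * r) ≤ K := div_le_self hK0 (by linarith)
          linarith
  refine ⟨hfi, ?_⟩
  have hlim := ((tendsto_integral_weighted hf hfi).sub (tendsto_integral_weighted hf₀ hi)).abs
  have hK' : Filter.Tendsto (fun n : ℕ ↦ K / (n + 1 : ℝ)) Filter.atTop (nhds 0) :=
    hat.const_div_atTop K
  have := le_of_tendsto_of_tendsto' hlim hK' fun n ↦ hK (n + 1 : ℝ) (by positivity)
  exact sub_eq_zero.1 (abs_nonpos_iff.1 this)

theorem integral_norm_sq_eq_norm_toLp_sq {f : ℝ → ℂ} (hf : MemLp f 2 (volume : Measure ℝ)) :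
    ∫ x, ‖f x‖ ^ 2 = ‖hf.toLp f‖ ^ 2 := by
  rw [← inner_self_eq_norm_sq (𝕜 := ℂ), L2.inner_def, ← integral_re (L2.integrable_inner _ _)]
  refine integral_congr_ae ?_
  filter_upwards [hf.coeFn_toLp] with x hx
  rw [hx, inner_self_eq_norm_sq]

theorem memLp_two_iff_integrable_norm_sq {f : ℝ → ℂ} (hf : Continuous f) :
    MemLp f 2 (volume : Measure ℝ) ↔ Integrable fun x ↦ ‖f x‖ ^ 2 :=
  memLp_two_iff_integrable_sq_norm hf.aestronglyMeasurable

/-- Bounds by the `H^s` norm of `m = u - u''`: in `L^∞` for `m` and `u ± u'`, and in `L²` for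
`u ± u'`. -/
theorem exists_momentum_bounds {s : ℝ} (hs : 1 / 2 < s) :
    ∃ C : ℝ, 0 ≤ C ∧ ∀ (u m : ℝ → ℂ) (g : Lp ℂ 2 (volume : Measure ℝ))
      (hm : MemLp m 2 (volume : Measure ℝ)), ContDiff ℝ 2 u → MemLp u 2 (volume : Measure ℝ) →
      (∀ x, m x = u x - iteratedDeriv 2 u x) →
      besselPotential ℝ ℂ s ((hm.toLp m : Lp ℂ 2 (volume : Measure ℝ)) : 𝓢'(ℝ, ℂ)) =
        (g : 𝓢'(ℝ, ℂ)) →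
      (∀ x, ‖m x‖ ≤ C * ‖g‖) ∧ (∀ x, ‖u x + deriv u x‖ ≤ C * ‖g‖) ∧
        (∀ x, ‖u x - deriv u x‖ ≤ C * ‖g‖) ∧
      Integrable (fun x ↦ ‖u x + deriv u x‖ ^ 2) ∧ Integrable (fun x ↦ ‖u x - deriv u x‖ ^ 2) ∧
      ∫ x, ‖u x + deriv u x‖ ^ 2 ≤ C * ‖g‖ ^ 2 ∧ ∫ x, ‖u x - deriv u x‖ ^ 2 ≤ C * ‖g‖ ^ 2 := by
  obtain ⟨C, hC, h⟩ := exists_norm_le_of_besselPotential_eq hs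
  refine ⟨C + 5, by positivity, fun u m g hm hu hu2 hmu hg ↦ ?_⟩
  have hd : Differentiable ℝ u := hu.differentiable (by norm_num)
  have hd1 : ContDiff ℝ 1 (deriv u) := by
    have : ContDiff ℝ (1 + 1) u := by simpa [one_add_one_eq_two] using hu
    exact (contDiff_succ_iff_deriv.1 this).2.2
  have hit : iteratedDeriv 2 u = deriv (deriv u) := by
    rw [iteratedDeriv_succ, iteratedDeriv_one]
  have hwc : Continuous (deriv (deriv u)) := hd1.continuous_deriv (by norm_num)
  have hme : m = fun x ↦ u x - deriv (deriv u) x := funext fun x ↦ by rw [hmu, hit]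
  have hmc : Continuous m := by rw [hme]; exact hu.continuous.sub hwc
  have hv : ∀ x, HasDerivAt u (deriv u x) x := fun x ↦ (hd x).hasDerivAt
  have hw : ∀ x, HasDerivAt (deriv u) (deriv (deriv u) x) x := fun x ↦
    (hd1.differentiable (by norm_num) x).hasDerivAt
  have hi := (memLp_two_iff_integrable_norm_sq hu.continuous).1 hu2
  have hmi := (memLp_two_iff_integrable_norm_sq hmc).1 hm
  have hN : ∫ x, ‖m x‖ ^ 2 ≤ ‖g‖ ^ 2 := by
    rw [integral_norm_sq_eq_norm_toLp_sq hm]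
    have := norm_le_of_besselPotential_eq (by linarith : 0 ≤ s) hg
    gcongr
  obtain ⟨p1, p2, p3⟩ := integrable_and_norm_sq_le_of_sign hv hw hwc hi
    (by simpa only [hme] using hmi) (Or.inl rfl : (1 : ℝ) = 1 ∨ (1 : ℝ) = -1)
  obtain ⟨q1, q2, q3⟩ := integrable_and_norm_sq_le_of_sign hv hw hwc hi
    (by simpa only [hme] using hmi) (Or.inr rfl : (-1 : ℝ) = 1 ∨ (-1 : ℝ) = -1)
  have hmI : ∫ x, ‖u x - deriv (deriv u) x‖ ^ 2 = ∫ x, ‖m x‖ ^ 2 := by simp only [hme]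
  simp only [hmI, Complex.ofReal_one, one_mul, Complex.ofReal_neg, neg_mul, ← sub_eq_add_neg]
    at p1 p2 p3 q1 q2 q3
  have hg0 := norm_nonneg g
  have hsup : ∀ a : ℝ, 0 ≤ a → a ^ 2 ≤ 18 * ∫ x, ‖m x‖ ^ 2 → a ≤ (C + 5) * ‖g‖ := by
    intro a ha h18
    have h1 : a ≤ 5 * ‖g‖ := abs_le_of_sq_le_sq' (by nlinarith) (by positivity) |>.2
    nlinarith [mul_nonneg hC hg0]
  have hL2 : 4 * ∫ x, ‖m x‖ ^ 2 ≤ (C + 5) * ‖g‖ ^ 2 := by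
    nlinarith [mul_nonneg hC (sq_nonneg ‖g‖), sq_nonneg ‖g‖]
  refine ⟨fun x ↦ (h m hm g hmc hg x).trans ?_, fun x ↦ hsup _ (norm_nonneg _) (p3 x),
    fun x ↦ hsup _ (norm_nonneg _) (q3 x), p1, q1, p2.trans hL2, q2.trans hL2⟩
  nlinarith

/-- The transport velocity is differentiable: with `p = u + u'` and `q = u - u'`, so that
`p' = p - m` and `q' = m - q`, one has `(p q̄)' = p m̄ - m q̄`. -/
theorem hasDerivAt_rotQ_re (θ : ℝ) {u m : ℝ → ℂ} (hu : ContDiff ℝ 2 u)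
    (hmu : ∀ x, m x = u x - iteratedDeriv 2 u x) (x : ℝ) :
    HasDerivAt (fun x ↦ (rotQ θ u x).re)
      (Complex.exp (Complex.I * θ) * ((u x + deriv u x) * starRingEnd ℂ (m x) -
        m x * starRingEnd ℂ (u x - deriv u x))).re x := by
  have hd : Differentiable ℝ u := hu.differentiable (by norm_num)
  have hd1 : ContDiff ℝ 1 (deriv u) := by
    have : ContDiff ℝ (1 + 1) u := by simpa [one_add_one_eq_two] using hu
    exact (contDiff_succ_iff_deriv.1 this).2.2
  have hit : iteratedDeriv 2 u = deriv (deriv u) := by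
    rw [iteratedDeriv_succ, iteratedDeriv_one]
  have hv : HasDerivAt u (deriv u x) x := (hd x).hasDerivAt
  have hw : HasDerivAt (deriv u) (deriv (deriv u) x) x :=
    (hd1.differentiable (by norm_num) x).hasDerivAt
  have hQ : HasDerivAt (rotQ θ u) (Complex.exp (Complex.I * θ) *
      ((deriv u x + deriv (deriv u) x) * (starRingEnd ℂ (u x) - starRingEnd ℂ (deriv u x)) +
        (u x + deriv u x) *
          (starRingEnd ℂ (deriv u x) - starRingEnd ℂ (deriv (deriv u) x)))) x :=
    ((hv.add hw).mul (hv.star.sub hw.star)).const_mul _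
  have hre := Complex.reCLM.hasFDerivAt.comp_hasDerivAt x hQ
  refine hre.congr_deriv ?_
  rw [Complex.reCLM_apply]
  congr 2
  rw [hmu, hit, map_sub, map_sub]
  ring

/-! ### Conservation of the `L¹` norm -/

theorem rotQ_eq (θ : ℝ) (u : ℝ → ℂ) (x : ℝ) :
    rotQ θ u x = Complex.exp (Complex.I * θ) *
      ((u x + deriv u x) * starRingEnd ℂ (u x - deriv u x)) := by
  rw [rotQ, Q, map_sub]

theorem IsSolution.continuous_momentum {θ s : ℝ} {m₀ : ℝ → ℂ} {T : EReal} {u m : ℝ → ℝ → ℂ}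
    (h : IsSolution θ s m₀ T u m) {t : ℝ} (ht : t ∈ timeInterval T) : Continuous (m t) := by
  have hu := h.contDiff t ht
  rw [show m t = fun x ↦ u t x - iteratedDeriv 2 (u t) x from funext (h.momentum t ht)]
  exact hu.continuous.sub (hu.continuous_iteratedDeriv 2 le_rfl)

/-- A solution is continuous and bounded, together with `u ± u_x`, on compact time intervals: time is
clamped to `[0, t]` so as to obtain functions on all of `ℝ × ℝ`. -/
theorem IsSolution.exists_bounds_on_Icc {θ s : ℝ} (hs : 1 / 2 < s) {m₀ : ℝ → ℂ} {T : EReal}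
    {u m : ℝ → ℝ → ℂ} (h : IsSolution θ s m₀ T u m) {t : ℝ} (ht : t ∈ timeInterval T) {c : ℝ → ℝ}
    (hc : Continuous c) (hct : ∀ τ, c τ ∈ Set.Icc 0 t) :
    (Continuous fun p : ℝ × ℝ ↦ m (c p.1) p.2) ∧
    (Continuous fun p : ℝ × ℝ ↦ u (c p.1) p.2 + deriv (u (c p.1)) p.2) ∧
    (Continuous fun p : ℝ × ℝ ↦ u (c p.1) p.2 - deriv (u (c p.1)) p.2) ∧
    ∃ K : ℝ, 0 ≤ K ∧ ∀ τ ∈ Set.Icc 0 t, (∀ x, ‖m τ x‖ ≤ K) ∧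
      Integrable (fun x ↦ ‖u τ x + deriv (u τ) x‖ ^ 2) ∧
      Integrable (fun x ↦ ‖u τ x - deriv (u τ) x‖ ^ 2) ∧
      ∫ x, ‖u τ x + deriv (u τ) x‖ ^ 2 ≤ K ∧ ∫ x, ‖u τ x - deriv (u τ) x‖ ^ 2 ≤ K := by
  obtain ⟨C, hC, hbound⟩ := exists_momentum_bounds hs
  obtain ⟨g, hg, hmg⟩ := h.continuous_sobolev
  have hsub : Set.Icc 0 t ⊆ timeInterval T := fun τ hτ ↦
    ⟨hτ.1, (EReal.coe_le_coe_iff.2 hτ.2).trans_lt ht.2⟩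
  have hgc : ContinuousOn g (timeInterval T) := hg.continuousOn
  have hG : Continuous fun τ ↦ g (c τ) :=
    hgc.comp_continuous hc fun τ ↦ hsub (hct τ)
  have hd : ∀ τ ∈ timeInterval T, Differentiable ℝ (u τ) := fun τ hτ ↦
    (h.contDiff τ hτ).differentiable (by norm_num)
  have hdc : ∀ τ ∈ timeInterval T, Continuous (deriv (u τ)) := fun τ hτ ↦
    (h.contDiff τ hτ).continuous_deriv (by norm_num)
  -- The equation `m = u - u''` is linear, so that differences obey the same bounds.
  have hdiff : ∀ τ ∈ timeInterval T, ∀ σ ∈ timeInterval T,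
      (∀ x, ‖m τ x - m σ x‖ ≤ C * ‖g τ - g σ‖) ∧
      (∀ x, ‖(u τ x + deriv (u τ) x) - (u σ x + deriv (u σ) x)‖ ≤ C * ‖g τ - g σ‖) ∧
      (∀ x, ‖(u τ x - deriv (u τ) x) - (u σ x - deriv (u σ) x)‖ ≤ C * ‖g τ - g σ‖) := by
    intro τ hτ σ hσ
    obtain ⟨h1, e1⟩ := hmg τ hτ
    obtain ⟨h2, e2⟩ := hmg σ hσ
    have hbes : besselPotential ℝ ℂ s
        ((((h1.sub h2).toLp (m τ - m σ) : Lp ℂ 2 (volume : Measure ℝ))) : 𝓢'(ℝ, ℂ)) =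
        ((g τ - g σ : Lp ℂ 2 (volume : Measure ℝ)) : 𝓢'(ℝ, ℂ)) := by
      rw [MemLp.toLp_sub h1 h2, ← Lp.toTemperedDistributionCLM_apply, map_sub, map_sub,
        ← Lp.toTemperedDistributionCLM_apply, map_sub, Lp.toTemperedDistributionCLM_apply,
        Lp.toTemperedDistributionCLM_apply, e1, e2]
      rfl
    have hder : ∀ x, deriv (u τ - u σ) x = deriv (u τ) x - deriv (u σ) x := fun x ↦
      deriv_sub (hd τ hτ x) (hd σ hσ x)
    obtain ⟨b1, b2, b3, -⟩ := hbound (u τ - u σ) (m τ - m σ) (g τ - g σ) (h1.sub h2)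
      ((h.contDiff τ hτ).sub (h.contDiff σ hσ)) ((h.memLp τ hτ).sub (h.memLp σ hσ))
      (fun x ↦ by
        rw [iteratedDeriv_sub (h.contDiff τ hτ).contDiffAt (h.contDiff σ hσ).contDiffAt]
        simp only [Pi.sub_apply, h.momentum τ hτ, h.momentum σ hσ]
        ring) hbes
    refine ⟨b1, fun x ↦ ?_, fun x ↦ ?_⟩
    · refine le_of_eq_of_le ?_ (b2 x)
      rw [hder, Pi.sub_apply]
      congr 1
      ring
    · refine le_of_eq_of_le ?_ (b3 x)
      rw [hder, Pi.sub_apply]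
      congr 1
      ring
  obtain ⟨N, hN⟩ := isCompact_Icc.exists_bound_of_continuousOn (hgc.mono hsub)
  have hN0 : 0 ≤ N := (norm_nonneg _).trans (hN t ⟨ht.1, le_rfl⟩)
  refine ⟨continuous_of_norm_sub_le (F := fun τ ↦ m (c τ))
      (fun τ ↦ h.continuous_momentum (hsub (hct τ))) hG
      fun τ σ ↦ (hdiff _ (hsub (hct τ)) _ (hsub (hct σ))).1,
    continuous_of_norm_sub_le (F := fun τ x ↦ u (c τ) x + deriv (u (c τ)) x)
      (fun τ ↦ (h.contDiff _ (hsub (hct τ))).continuous.add (hdc _ (hsub (hct τ)))) hG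
      fun τ σ ↦ (hdiff _ (hsub (hct τ)) _ (hsub (hct σ))).2.1,
    continuous_of_norm_sub_le (F := fun τ x ↦ u (c τ) x - deriv (u (c τ)) x)
      (fun τ ↦ (h.contDiff _ (hsub (hct τ))).continuous.sub (hdc _ (hsub (hct τ)))) hG
      fun τ σ ↦ (hdiff _ (hsub (hct τ)) _ (hsub (hct σ))).2.2,
    C * N + C * N ^ 2, by positivity, fun τ hτ ↦ ?_⟩
  obtain ⟨hτm, e⟩ := hmg τ (hsub hτ)
  obtain ⟨b1, -, -, b4, b5, b6, b7⟩ := hbound (u τ) (m τ) (g τ) hτm (h.contDiff τ (hsub hτ))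
    (h.memLp τ (hsub hτ)) (h.momentum τ (hsub hτ)) e
  have h1 : C * ‖g τ‖ ≤ C * N + C * N ^ 2 := by
    have := mul_le_mul_of_nonneg_left (hN τ hτ) hC
    have : 0 ≤ C * N ^ 2 := by positivity
    linarith
  have h2 : C * ‖g τ‖ ^ 2 ≤ C * N + C * N ^ 2 := by
    have : C * ‖g τ‖ ^ 2 ≤ C * N ^ 2 := by
      have := hN τ hτ
      gcongr
    have : 0 ≤ C * N := by positivity
    linarith
  exact ⟨fun x ↦ (b1 x).trans h1, b4, b5, b6.trans h2, b7.trans h2⟩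

/-- The flux through the weight `1 - x² / R²` is `O(1 / R)`, as `m` is bounded and the velocity is a
product of square integrable functions. -/
theorem integral_flux_le {m p q : ℝ → ℂ} {J : ℝ → ℝ} {K R : ℝ} (hR : 0 < R)
    (hmK : ∀ x, ‖m x‖ ≤ K) (hJpq : ∀ x, |J x| ≤ ‖p x‖ * ‖q x‖)
    (hp : Integrable fun x ↦ ‖p x‖ ^ 2) (hq : Integrable fun x ↦ ‖q x‖ ^ 2)
    (hpK : ∫ x, ‖p x‖ ^ 2 ≤ K) (hqK : ∫ x, ‖q x‖ ^ 2 ≤ K) :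
    ∫ x in -R..R, ‖m x‖ * |J x| * |-(2 * x / R ^ 2)| ≤ 2 * K ^ 2 / R := by
  have hK : 0 ≤ K := (norm_nonneg _).trans (hmK 0)
  have hpt : ∀ x ∈ Set.Ioc (-R) R, ‖‖m x‖ * |J x| * |-(2 * x / R ^ 2)|‖ ≤
      K / R * (‖p x‖ ^ 2 + ‖q x‖ ^ 2) := fun x hx ↦ by
    have h1 : |-(2 * x / R ^ 2)| ≤ 2 / R := by
      rw [abs_neg, abs_div, abs_mul, abs_two, abs_of_pos (by positivity : 0 < R ^ 2),
        div_le_div_iff₀ (by positivity) hR]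
      have : |x| ≤ R := abs_le.2 ⟨hx.1.le, hx.2⟩
      nlinarith
    have h2 : |J x| ≤ (‖p x‖ ^ 2 + ‖q x‖ ^ 2) / 2 := by
      nlinarith [hJpq x, sq_nonneg (‖p x‖ - ‖q x‖)]
    rw [Real.norm_of_nonneg (by positivity)]
    calc _ ≤ K * ((‖p x‖ ^ 2 + ‖q x‖ ^ 2) / 2) * (2 / R) := by
          have := hmK x
          gcongr
      _ = _ := by ring
  have hi : Integrable fun x ↦ K / R * (‖p x‖ ^ 2 + ‖q x‖ ^ 2) := (hp.add hq).const_mul _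
  calc _ ≤ ∫ x in -R..R, K / R * (‖p x‖ ^ 2 + ‖q x‖ ^ 2) :=
        (le_abs_self _).trans (intervalIntegral.norm_integral_le_of_norm_le (by linarith)
          (Filter.Eventually.of_forall hpt) hi.intervalIntegrable)
    _ ≤ ∫ x, K / R * (‖p x‖ ^ 2 + ‖q x‖ ^ 2) := by
        rw [intervalIntegral.integral_of_le (by linarith)]
        exact setIntegral_le_integral hi (Filter.Eventually.of_forall fun x ↦ by
          simp only [Pi.zero_apply]; positivity)
    _ = K / R * ((∫ x, ‖p x‖ ^ 2) + ∫ x, ‖q x‖ ^ 2) := by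
        rw [integral_const_mul, integral_add hp hq]
    _ ≤ K / R * (K + K) := by gcongr
    _ = _ := by ring

/-- Conservation of the `L¹` norm along a solution. -/
theorem IsSolution.integrable_and_integral_norm_eq {θ s : ℝ} (hs : 1 / 2 < s) {m₀ : ℝ → ℂ}
    (hm₀ : Integrable m₀) {T : EReal} {u m : ℝ → ℝ → ℂ} (h : IsSolution θ s m₀ T u m) {t : ℝ}
    (ht : t ∈ timeInterval T) :
    Integrable (m t) ∧ ∫ x, ‖m t x‖ = ∫ x, ‖m₀ x‖ := by
  have h0 : ∫ x, ‖m 0 x‖ = ∫ x, ‖m₀ x‖ :=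
    integral_congr_ae (h.initial.mono fun x hx ↦ by simp only [hx])
  have hi0 : Integrable (m 0) := hm₀.congr h.initial.symm
  rcases ht.1.eq_or_lt with rfl | htpos
  · exact ⟨hi0, h0⟩
  have hsub : Set.Icc 0 t ⊆ timeInterval T := fun τ hτ ↦
    ⟨hτ.1, (EReal.coe_le_coe_iff.2 hτ.2).trans_lt ht.2⟩
  set c : ℝ → ℝ := fun τ ↦ max 0 (min τ t) with hc
  have hcc : Continuous c := by fun_prop
  have hct : ∀ τ, c τ ∈ Set.Icc 0 t := fun τ ↦ ⟨le_max_left _ _, max_le ht.1 (min_le_right _ _)⟩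
  have hcid : ∀ τ ∈ Set.Icc 0 t, c τ = τ := fun τ hτ ↦ by
    simp only [hc, min_eq_left hτ.2, max_eq_right hτ.1]
  obtain ⟨hmc, hpc, hqc, K, hK, hb⟩ := h.exists_bounds_on_Icc hs ht hcc hct
  have hQc : Continuous fun p : ℝ × ℝ ↦ rotQ θ (u (c p.1)) p.2 := by
    simp only [rotQ_eq]
    exact continuous_const.mul (hpc.mul (Complex.continuous_conj.comp hqc))
  have hJc : Continuous fun p : ℝ × ℝ ↦ (rotQ θ (u (c p.1)) p.2).re :=
    Complex.continuous_re.comp hQc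
  have hJxc : Continuous fun p : ℝ × ℝ ↦ (Complex.exp (Complex.I * θ) *
      ((u (c p.1) p.2 + deriv (u (c p.1)) p.2) * starRingEnd ℂ (m (c p.1) p.2) -
        m (c p.1) p.2 * starRingEnd ℂ (u (c p.1) p.2 - deriv (u (c p.1)) p.2))).re :=
    Complex.continuous_re.comp (continuous_const.mul
      ((hpc.mul (Complex.continuous_conj.comp hmc)).sub
        (hmc.mul (Complex.continuous_conj.comp hqc))))
  have hweak : ∀ τ ∈ Set.Ioo 0 t, ∀ φ : ℝ → ℝ, ContDiff ℝ (⊤ : ℕ∞) φ → HasCompactSupport φ →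
      HasDerivAt (fun σ ↦ ∫ y, m (c σ) y * (φ y : ℂ))
        ((∫ y, ((rotQ θ (u (c τ)) y).re : ℂ) * m (c τ) y * ((deriv φ y : ℝ) : ℂ)) +
          ∫ y, Complex.I * ((rotQ θ (u (c τ)) y).im : ℂ) * m (c τ) y * (φ y : ℂ)) τ := by
    intro τ hτ φ hφ hφs
    have hcs : HasCompactSupport (fun y ↦ (φ y : ℂ)) :=
      hφs.comp_left (g := fun r : ℝ ↦ (r : ℂ)) rfl
    have hcd : ContDiff ℝ (⊤ : ℕ∞) (fun y ↦ (φ y : ℂ)) := Complex.ofRealCLM.contDiff.comp hφ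
    have hder : ∀ y, deriv (fun y ↦ (φ y : ℂ)) y = ((deriv φ y : ℝ) : ℂ) := fun y ↦
      ((hφ.differentiable (by simp) y).hasDerivAt.ofReal_comp).deriv
    have hIoo : Set.Ioo 0 t ∈ nhds τ := Ioo_mem_nhds hτ.1 hτ.2
    have h1 := (h.equation τ (hsub (Set.Ioo_subset_Icc_self hτ)) (hcs.toSchwartzMap hcd)).hasDerivAt
      (Filter.mem_of_superset hIoo (Set.Ioo_subset_Icc_self.trans hsub))
    have h2 : ⇑(hcs.toSchwartzMap hcd) = fun y ↦ (φ y : ℂ) := rfl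
    simp only [h2, hder] at h1
    rw [hcid τ (Set.Ioo_subset_Icc_self hτ)]
    refine h1.congr_of_eventuallyEq ?_
    filter_upwards [hIoo] with σ hσ
    rw [hcid σ (Set.Ioo_subset_Icc_self hσ)]
  have hJpq : ∀ τ x, |(rotQ θ (u τ) x).re| ≤
      ‖u τ x + deriv (u τ) x‖ * ‖u τ x - deriv (u τ) x‖ := fun τ x ↦ by
    refine (Complex.abs_re_le_norm _).trans (le_of_eq ?_)
    rw [rotQ_eq, norm_mul, norm_mul, RCLike.norm_conj, Complex.norm_exp]
    simp
  have hlocal : ∀ R > 0, |(∫ x in -R..R, ‖m t x‖ * (1 - x ^ 2 / R ^ 2)) -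
      ∫ x in -R..R, ‖m 0 x‖ * (1 - x ^ 2 / R ^ 2)| ≤ 2 * K ^ 2 * t / R := by
    intro R hR
    have hχ : ∀ x, HasDerivAt (fun x : ℝ ↦ 1 - x ^ 2 / R ^ 2) (-(2 * x / R ^ 2)) x := fun x ↦ by
      simpa using ((hasDerivAt_pow 2 x).div_const (R ^ 2)).const_sub 1
    have key := abs_integral_norm_sub_le (m := fun τ ↦ m (c τ))
      (J := fun τ x ↦ (rotQ θ (u (c τ)) x).re) (ω := fun τ x ↦ (rotQ θ (u (c τ)) x).im)
      (A := 2 * K ^ 2 / R) htpos hR.le hmc hJc hJxc (Complex.continuous_im.comp hQc)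
      (fun τ ↦ hasDerivAt_rotQ_re θ (h.contDiff _ (hsub (hct τ))) (h.momentum _ (hsub (hct τ))))
      hweak hχ (by fun_prop) (by field_simp; simp) (by field_simp; simp)
      (fun τ hτ ↦ by
        obtain ⟨b1, b2, b3, b4, b5⟩ := hb _ (hct τ)
        exact integral_flux_le hR b1 (hJpq _) b2 b3 b4 b5)
    rw [hcid t ⟨ht.1, le_rfl⟩, hcid 0 ⟨le_rfl, ht.1⟩] at key
    exact key.trans (le_of_eq (by ring))
  obtain ⟨h1, h2⟩ := integrable_and_integral_eq_of_weighted
    (h.continuous_momentum ht).norm (h.continuous_momentum (hsub ⟨le_rfl, ht.1⟩)).norm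
    (fun _ ↦ norm_nonneg _) (fun _ ↦ norm_nonneg _) hi0.norm hlocal
  exact ⟨(integrable_norm_iff (h.continuous_momentum ht).aestronglyMeasurable).1 h1, h2.trans h0⟩

end Peakon

theorem theorem2p2 (θ : ℝ) (hθ : θ ∈ Set.Ico 0 Real.pi) (s : ℝ) (hs : 1 / 2 < s)
    (m₀ : ℝ → ℂ) (hm₀ : Peakon.MemSobolevSpace s m₀)
    (hm₀' : MeasureTheory.Integrable m₀ MeasureTheory.volume)
    (Tstar : EReal) (u m : ℝ → ℝ → ℂ) (hm : Peakon.IsMaximalSolution θ s m₀ Tstar u m) :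
    ∀ t ∈ Peakon.timeInterval Tstar,
      MeasureTheory.Integrable (m t) MeasureTheory.volume ∧
      HasDerivWithinAt (fun τ : ℝ ↦ ∫ x : ℝ, ‖m τ x‖) 0 (Peakon.timeInterval Tstar) t ∧
      ∫ x : ℝ, ‖m t x‖ = ∫ x : ℝ, ‖m₀ x‖ := by
  intro t ht
  have key := fun τ hτ ↦
    hm.isSolution.integrable_and_integral_norm_eq hs hm₀' (t := τ) hτ
  exact ⟨(key t ht).1, (hasDerivWithinAt_const t _ _).congr (fun τ hτ ↦ (key τ hτ).2)
    (key t ht).2, (key t ht).2⟩
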